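/- **Setting.** Let $(E,\|\cdot\|)$ be a complete normed vector space with its Borel $\sigma$-field, $E_\cup:=\bigcup_{k\ge1}E^k$ (each $E^k$ carrying the product $\sigma$-field), and $\mathcal G$ a set of measurable functions $g:E_\cup\to\mathbb R$. For each $n$ let $X_{n,1},\dots,X_{n,n}$ be $E$-valued random variables on a probability space (which may depend on $n$). Let $s_n,l_n,r_n\in\mathbb N=\{1,2,\dots\}$ and $b_n(g)>0$ $(g\in\mathcal G)$, and put $m_n:=\lfloor (n-s_n+1)/r_n\rfloor$ (read as $0$ if $s_n>n$), $$Y_{n,j}:=(X_{n,j},\dots,X_{n,j+s_n-1}),\qquad V_{n,i}(g):=\frac1{b_n(g)}\sum_{j=1}^{r_n}g(Y_{n,(i-1)r_n+j}),\qquad V_n:=V_{n,1},\qquad p_n:=P\{\exists g\in\mathcal G: V_n(g)\ne0\},$$ where $P$ is read as outer probability on sets that are not measurable. All these objects are defined for $n$ so large that $r_n+s_n-1\le n$; only such $n$ matter below. Let $$\bar Z_n(g):=\frac1{\sqrt{p_n}\,b_n(g)}\sum_{j=1}^{n-s_n+1}\big(g(Y_{n,j})-Eg(Y_{n,j})\big),\qquad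 Z_n(g):=\frac1{\sqrt{p_n}\,b_n(g)}\sum_{j=1}^{m_nr_n}\big(g(Y_{n,j})-Eg(Y_{n,j})\big),\qquad g\in\mathcal G.$$ With $\mathcal B_{n,i}^j:=\sigma(X_{n,i},\dots,X_{n,j})$ let $$\beta^X_{n,k}:=\sup_{1\le l\le n-k-1}E\Big[\sup_{B\in\mathcal B_{n,l+k+1}^n}\big|P(B\mid\mathcal B_{n,1}^l)-P(B)\big|\Big],$$ the inner supremum being understood as an essential supremum. **Theorem.** Suppose that $g_{\max}:=\sup_{g\in\mathcal G}|g|$ is bounded and measurable, and that: * (A1) for every $n$, $(X_{n,i})_{1\le i\le n}$ is stationary; * (A2) $s_n\le l_n$ for all $n$, $l_n=o(r_n)$, $r_n=o(n)$, $p_n\to0$ and $r_n=o\big(\sqrt{p_n}\inf_{g\in\mathcal G}b_n(g)\big)$; * (D0) the processes $(V_n(g))_{g\in\mathcal G}$ are separable, i.e. for every $n$ (with $r_n+s_n-1\le n$) there is a countable $\mathcal G_n\subset\mathcal G$ such that, almost surely, every value $V_n(g)$, $g\in\mathcal G$, is a limit of values of $V_n$ on $\mathcal G_n$ (this holds if $V_n$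 is separable with respect to some topology on $\mathcal G$); * (MX) $m_n\,\beta^X_{n,l_n-s_n}\to0$; * for every $g\in\mathcal G$, $$E\Big[\Big(\sum_{j=1}^{r_n}\mathbf 1_{\{g(Y_{n,j})\ne0\}}\Big)^2\Big]=O\Big(\frac{p_n\,b_n^2(g)}{m_n}\Big).$$ Then $\sup_{g\in\mathcal G}|Z_n(g)-\bar Z_n(g)|\to0$ in outer probability. If, in addition, (C) there is a function $c:\mathcal G^2\to\mathbb R$ such that $\frac{m_n}{p_n}\operatorname{Cov}\big(V_n(g),V_n(h)\big)\to c(g,h)$ for all $g,h\in\mathcal G$, then there is a centered Gaussian process $(Z(g))_{g\in\mathcal G}$ with covariance function $c$ such that the finite-dimensional marginal distributions of $(Z_n(g))_{g\in\mathcal G}$ and those of $(\bar Z_n(g))_{g\in\mathcal G}$ both converge weakly to those of $(Z(g))_{g\in\mathcal G}$. -/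

import Mathlib

open MeasureTheory ProbabilityTheory Filter Asymptotics
open scoped Topology ENNReal NNReal

namespace SlidingBlocks

noncomputable section

/-- `E_∪ = ⋃_{k ≥ 1} E^k`, the vectors of arbitrary positive length with components in `E`; it
carries the sum of the product σ-fields on the spaces `E^k`. -/
abbrev Vectors (E : Type*) : Type _ := Σ k : ℕ+, (Fin k → E)

/-- The envelope `g_max = sup_{g ∈ 𝒢} |g|`, with values in `[0, ∞]`. -/
def envelope {S : Type*} (𝒢 : Set (S → ℝ)) (x : S) : ℝ≥0∞ := ⨆ g : 𝒢, ‖g.1 x‖ₑ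

/-! ### The observations

Row `n` of the array lives on a space `Ω n` and consists of `X n 1, …, X n n`. The values of `X n i`
for `i = 0` and `i > n` play no role. -/

/-- The finite family `ξ 1, …, ξ n` is (strictly) stationary: `(ξ 1, …, ξ k)` and
`(ξ (h+1), …, ξ (h+k))` have the same law whenever `h + k ≤ n`. -/
def IsStationaryRow {Ω E : Type*} [MeasurableSpace Ω] [MeasurableSpace E]
    (P : Measure Ω) (n : ℕ) (ξ : ℕ → Ω → E) : Prop :=
  ∀ h k : ℕ, h + k ≤ n →
    P.map (fun ω (i : Fin k) => ξ (h + i + 1) ω) = P.map (fun ω (i : Fin k) => ξ (i + 1) ω)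

/-- The σ-field generated by `ξ i, …, ξ j`. -/
abbrev sigmaField {Ω E : Type*} [mE : MeasurableSpace E] (ξ : ℕ → Ω → E) (i j : ℕ) :
    MeasurableSpace Ω :=
  ⨆ l ∈ Finset.Icc i j, mE.comap (ξ l)

/-- `E [ sup_{B ∈ ℬ} |P(B | 𝒜) - P(B)| ]`. Conditional probabilities are defined up to null
sets only and `ℬ` may be uncountable, so the supremum is the essential one, i.e. the almost surely
smallest measurable `h` with `|P(B | 𝒜) - P(B)| ≤ h` almost surely for each `B ∈ ℬ`; its
expectation is the infimum of the expectations of these `h`. -/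
def betaCoeff {Ω : Type*} [mΩ : MeasurableSpace Ω] (P : Measure Ω) (𝒜 ℬ : MeasurableSpace Ω) :
    ℝ≥0∞ :=
  ⨅ (h : Ω → ℝ≥0∞) (_ : Measurable[mΩ] h)
    (_ : ∀ B : Set Ω, MeasurableSet[ℬ] B → ∀ᵐ ω ∂P, ‖(P⟦B | 𝒜⟧) ω - P.real B‖ₑ ≤ h ω),
    ∫⁻ ω, h ω ∂P

/-- The mixing coefficient `β_{n,k}` of the row `ξ 1, …, ξ n`: the supremum over
`1 ≤ l ≤ n - k - 1` of the coefficient between `σ(ξ 1, …, ξ l)` and `σ(ξ (l+k+1), …, ξ n)`. -/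
def betaMixing {Ω E : Type*} [MeasurableSpace Ω] [MeasurableSpace E]
    (P : Measure Ω) (n : ℕ) (ξ : ℕ → Ω → E) (k : ℕ) : ℝ≥0∞ :=
  ⨆ l ∈ Finset.Icc 1 (n - k - 1), betaCoeff P (sigmaField ξ 1 l) (sigmaField ξ (l + k + 1) n)

section Empirical

variable {E : Type*} {Ω : ℕ → Type*} [∀ n, MeasurableSpace (Ω n)]

/-- The block `Y_{n,j} = (X_{n,j}, …, X_{n,j+s_n-1})`. -/
def block (X : ∀ n, ℕ → Ω n → E) (s : ℕ → ℕ+) (n j : ℕ) (ω : Ω n) : Vectors E :=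
  ⟨s n, fun i => X n (j + i) ω⟩

/-- `m_n = ⌊(n - s_n + 1) / r_n⌋` (which is `0` if `s_n > n`). -/
def numBlocks (s r : ℕ → ℕ+) (n : ℕ) : ℕ := (n + 1 - s n) / r n

/-- `V_{n,i}(g) = b_n(g)⁻¹ ∑_{j=1}^{r_n} g(Y_{n,(i-1) r_n + j})`, for `i ≥ 1`. -/
def bigBlock (X : ∀ n, ℕ → Ω n → E) (s r : ℕ → ℕ+) {𝒢 : Set (Vectors E → ℝ)} (b : ℕ → 𝒢 → ℝ)
    (n i : ℕ) (g : 𝒢) (ω : Ω n) : ℝ :=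
  (∑ j ∈ Finset.Icc 1 (r n : ℕ), g.1 (block X s n ((i - 1) * r n + j) ω)) / b n g

/-- `p_n = P{∃ g ∈ 𝒢 : V_n(g) ≠ 0}`, where `V_n = V_{n,1}`. -/
def hitProb (μ : ∀ n, Measure (Ω n)) (X : ∀ n, ℕ → Ω n → E) (s r : ℕ → ℕ+)
    {𝒢 : Set (Vectors E → ℝ)} (b : ℕ → 𝒢 → ℝ) (n : ℕ) : ℝ :=
  (μ n).real {ω | ∃ g : 𝒢, bigBlock X s r b n 1 g ω ≠ 0}

/-- `(√p_n b_n(g))⁻¹ ∑_{j=1}^{N} (g(Y_{n,j}) - E g(Y_{n,j}))`. -/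
def centeredSum (μ : ∀ n, Measure (Ω n)) (X : ∀ n, ℕ → Ω n → E) (s r : ℕ → ℕ+)
    {𝒢 : Set (Vectors E → ℝ)} (b : ℕ → 𝒢 → ℝ) (N n : ℕ) (g : 𝒢) (ω : Ω n) : ℝ :=
  (∑ j ∈ Finset.Icc 1 N, (g.1 (block X s n j ω) - ∫ ω', g.1 (block X s n j ω') ∂(μ n))) /
    (√(hitProb μ X s r b n) * b n g)

/-- The sliding blocks process `Z̄_n(g)`: the sum over all `n - s_n + 1` blocks. -/
def empSliding (μ : ∀ n, Measure (Ω n)) (X : ∀ n, ℕ → Ω n → E) (s r : ℕ → ℕ+)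
    {𝒢 : Set (Vectors E → ℝ)} (b : ℕ → 𝒢 → ℝ) (n : ℕ) : 𝒢 → Ω n → ℝ :=
  centeredSum μ X s r b (n + 1 - s n) n

/-- The big blocks approximation `Z_n(g)`: the sum over the first `m_n r_n` blocks. -/
def empBigBlock (μ : ∀ n, Measure (Ω n)) (X : ∀ n, ℕ → Ω n → E) (s r : ℕ → ℕ+)
    {𝒢 : Set (Vectors E → ℝ)} (b : ℕ → 𝒢 → ℝ) (n : ℕ) : 𝒢 → Ω n → ℝ :=
  centeredSum μ X s r b (numBlocks s r n * r n) n

end Empirical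

/-- A real process with index set `T` is separable: outside a null set, each of its values is a
limit of values on one countable subset of `T`. No topology on `T` is singled out, so this is
separability with respect to the coarsest topology; separability (in the sense of Doob) with respect
to any other topology or semi-metric on `T` implies it. -/
def IsSeparable {Ω T : Type*} [MeasurableSpace Ω] (P : Measure Ω) (V : T → Ω → ℝ) : Prop :=
  ∃ T₀ : Set T, T₀.Countable ∧ ∀ᵐ ω ∂P, ∀ t : T, V t ω ∈ closure ((fun t' => V t' ω) '' T₀)

/-- Convergence to `0` in outer probability of `[0, ∞]`-valued maps `W n`, which need not be
measurable: on arbitrary sets, a `Measure` of Mathlib is the outer measure. -/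
def TendstoZeroOuterProb {Ω : ℕ → Type*} [∀ n, MeasurableSpace (Ω n)] (μ : ∀ n, Measure (Ω n))
    (W : ∀ n, Ω n → ℝ≥0∞) : Prop :=
  ∀ ε : ℝ≥0∞, 0 < ε → Tendsto (fun n => μ n {ω | ε < W n ω}) atTop (𝓝 0)

/-- The finite-dimensional marginal distributions of the processes `W n` converge weakly to those
of the coordinate process on `ℝ^T` under `Q`. -/
def FidisTendsto {Ω : ℕ → Type*} [∀ n, MeasurableSpace (Ω n)] (μ : ∀ n, Measure (Ω n))
    [∀ n, IsProbabilityMeasure (μ n)] {T : Type*} (W : ∀ n, T → Ω n → ℝ)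
    (Q : Measure (T → ℝ)) [IsProbabilityMeasure Q] : Prop :=
  ∀ I : Finset T,
    TendstoInDistribution (fun n ω => I.restrict (fun t => W n t ω)) atTop
      (fun z : T → ℝ => I.restrict z) μ Q

end

end SlidingBlocks

namespace SlidingBlocks

/-! ### The Kolmogorov extension theorem for real processes -/

/-- Cylinders over compact sets have the countable intersection property. -/
lemma nonempty_iInter_cylinder_of_isCompact {T : Type*} (I : ℕ → Finset T)
    (K : ∀ n, Set (I n → ℝ)) (hK : ∀ n, IsCompact (K n))
    (hne : ∀ n, (⋂ k ≤ n, cylinder (α := fun _ : T => ℝ) (I k) (K k)).Nonempty) :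
    (⋂ k, cylinder (α := fun _ : T => ℝ) (I k) (K k)).Nonempty := by
  classical
  choose x hx using hne
  have hx' : ∀ n k, k ≤ n → (I k).restrict (x n) ∈ K k := fun n k hk => by
    have := hx n
    simp only [Set.mem_iInter, mem_cylinder] at this
    exact this k hk
  have hC : ∀ t : T, ∃ C : Set ℝ, IsCompact C ∧ C.Nonempty ∧
      ∀ n, (∃ k ≤ n, t ∈ I k) → x n t ∈ C := by
    intro t
    by_cases h : ∃ k, t ∈ I k
    · refine ⟨(fun z : I (Nat.find h) → ℝ => z ⟨t, Nat.find_spec h⟩) '' K (Nat.find h),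
        (hK _).image (continuous_apply _), ⟨_, Set.mem_image_of_mem _ (hx' _ _ le_rfl)⟩, ?_⟩
      rintro n ⟨k, hkn, hk⟩
      exact ⟨_, hx' n (Nat.find h) ((Nat.find_min' h hk).trans hkn), rfl⟩
    · exact ⟨{0}, isCompact_singleton, Set.singleton_nonempty 0,
        fun n ⟨k, _, hk⟩ => absurd ⟨k, hk⟩ h⟩
  choose C hCc hCn hCx using hC
  have hcl : ∀ k, IsClosed (cylinder (α := fun _ : T => ℝ) (I k) (K k)) := fun k =>
    (hK k).isClosed.preimage (by fun_prop)
  have key := IsCompact.nonempty_iInter_of_sequence_nonempty_isCompact_isClosed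
    (fun n => Set.univ.pi C ∩ ⋂ k ≤ n, cylinder (α := fun _ : T => ℝ) (I k) (K k))
    (fun n => Set.inter_subset_inter_right _
      (Set.biInter_subset_biInter_left fun k (hk : k ≤ n) => Nat.le_succ_of_le hk))
    (fun n => ?_) ?_ (fun n => ?_)
  · refine key.mono fun z hz => ?_
    simp only [Set.mem_iInter, Set.mem_inter_iff] at hz ⊢
    exact fun k => (hz k).2 k le_rfl
  · refine ⟨fun t => if ∃ k ≤ n, t ∈ I k then x n t else (hCn t).some, ?_, ?_⟩
    · intro t _
      dsimp only
      split_ifs with h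
      · exact hCx t n h
      · exact (hCn t).some_mem
    · simp only [Set.mem_iInter, mem_cylinder]
      intro k hk
      convert hx' n k hk using 1
      ext t
      have : ∃ k ≤ n, (t : T) ∈ I k := ⟨k, hk, t.2⟩
      simp [Finset.restrict, this]
  · exact (isCompact_univ_pi hCc).inter_right
      (isClosed_biInter fun k _ => hcl k)
  · exact (isCompact_univ_pi hCc).isClosed.inter (isClosed_biInter fun k _ => hcl k)

lemma projectiveFamilyContent_tendsto_zero {T : Type*} {P : ∀ J : Finset T, Measure (J → ℝ)}
    [∀ J, IsFiniteMeasure (P J)] (hP : IsProjectiveMeasureFamily (α := fun _ : T => ℝ) P)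
    {A : ℕ → Set (T → ℝ)} (hA : ∀ n, A n ∈ measurableCylinders (fun _ : T => ℝ))
    (hanti : Antitone A) (hemp : ⋂ n, A n = ∅) :
    Tendsto (fun n => projectiveFamilyContent hP (A n)) atTop (𝓝 0) := by
  have hmono : Antitone fun n => projectiveFamilyContent hP (A n) := fun m n hmn =>
    projectiveFamilyContent_mono hP (hA n) (hA m) (hanti hmn)
  have hlim := tendsto_atTop_iInf hmono
  by_contra hcon
  have hne : (⨅ n, projectiveFamilyContent hP (A n)) ≠ 0 := fun h => hcon (h ▸ hlim)
  obtain ⟨ε', hε', hsum⟩ := ENNReal.exists_pos_sum_of_countable' hne ℕ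
  choose I S hS hAS using fun n => (mem_measurableCylinders _).1 (hA n)
  choose K hKS hK hKcl hKε using fun n => (hS n).exists_isCompact_isClosed_sdiff_lt
    (μ := P (I n)) (measure_ne_top _ _) (hε' n).ne'
  have hcyl : ∀ k, cylinder (I k) (K k) ∈ measurableCylinders (fun _ : T => ℝ) := fun k =>
    cylinder_mem_measurableCylinders _ _ (hKcl k).measurableSet
  refine absurd (nonempty_iInter_cylinder_of_isCompact I K hK fun n => ?_) ?_
  · by_contra hempty
    rw [Set.not_nonempty_iff_eq_empty] at hempty
    have hsub : A n ⊆ ⋃ k ∈ Finset.range (n + 1), (A k \ cylinder (I k) (K k)) := by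
      intro z hz
      by_contra hz'
      simp only [Set.mem_iUnion, Finset.mem_range, Set.mem_sdiff, exists_prop, not_exists, not_and,
        not_not] at hz'
      have : z ∈ ⋂ k ≤ n, cylinder (α := fun _ : T => ℝ) (I k) (K k) := by
        simp only [Set.mem_iInter]
        exact fun k hk => hz' k (by lia) (hanti hk hz)
      simp [hempty] at this
    have hd : ∀ k, A k \ cylinder (I k) (K k) ∈ measurableCylinders (fun _ : T => ℝ) := fun k =>
      isSetRing_measurableCylinders.sdiff_mem (hA k) (hcyl k)
    have hval : ∀ k, projectiveFamilyContent hP (A k \ cylinder (I k) (K k)) ≤ ε' k := by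
      intro k
      rw [projectiveFamilyContent_congr hP (I := I k) (S := S k \ K k) _ ?_
        ((hS k).diff (hKcl k).measurableSet)]
      · exact (hKε k).le
      · rw [hAS k]; rfl
    have : (⨅ n, projectiveFamilyContent hP (A n)) ≤ ∑' k, ε' k := by
      calc _ ≤ projectiveFamilyContent hP (A n) := iInf_le _ n
        _ ≤ projectiveFamilyContent hP
            (⋃ k ∈ Finset.range (n + 1), (A k \ cylinder (I k) (K k))) :=
          projectiveFamilyContent_mono hP (hA n)
            (isSetRing_measurableCylinders.biUnion_mem _ fun k _ => hd k) hsub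
        _ ≤ ∑ k ∈ Finset.range (n + 1),
            projectiveFamilyContent hP (A k \ cylinder (I k) (K k)) :=
          addContent_biUnion_le isSetRing_measurableCylinders fun k _ => hd k
        _ ≤ ∑ k ∈ Finset.range (n + 1), ε' k := Finset.sum_le_sum fun k _ => hval k
        _ ≤ ∑' k, ε' k := ENNReal.sum_le_tsum _
    exact absurd hsum (not_lt.2 this)
  · rw [Set.not_nonempty_iff_eq_empty, ← Set.subset_empty_iff, ← hemp]
    exact Set.iInter_mono fun k => by
      rw [hAS k]
      exact Set.preimage_mono (hKS k)

/-- **Kolmogorov extension theorem** for real-valued processes. -/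
theorem exists_isProjectiveLimit {T : Type*} {P : ∀ J : Finset T, Measure (J → ℝ)}
    [∀ J, IsFiniteMeasure (P J)] (hP : IsProjectiveMeasureFamily (α := fun _ : T => ℝ) P) :
    ∃ Q : Measure (T → ℝ), IsProjectiveLimit Q P := by
  have hsub : (projectiveFamilyContent hP).IsSigmaSubadditive :=
    isSigmaSubadditive_of_addContent_iUnion_eq_tsum isSetRing_measurableCylinders
      fun f hf hU hd => addContent_iUnion_eq_sum_of_tendsto_zero isSetRing_measurableCylinders
        _ (fun _ _ => projectiveFamilyContent_ne_top hP)
        (fun _ hs => projectiveFamilyContent_tendsto_zero hP hs) hf hU hd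
  refine ⟨(projectiveFamilyContent hP).measure isSetSemiring_measurableCylinders
    generateFrom_measurableCylinders.ge hsub, fun J => ?_⟩
  ext s hs
  rw [Measure.map_apply (Finset.measurable_restrict J) hs,
    AddContent.measure_eq _ _ generateFrom_measurableCylinders.symm, ← cylinder,
    projectiveFamilyContent_cylinder hP hs]
  exact cylinder_mem_measurableCylinders _ _ hs

/-! ### Gaussian processes with a given covariance function -/

/-- The restriction of a kernel to a finite set of indices, as a matrix. -/
abbrev kernelMatrix {T : Type*} (c : T → T → ℝ) (I : Finset T) : Matrix I I ℝ :=
  Matrix.of fun i j => c i j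

open Classical in
/-- The law `Q` on `ℝ^T` has centered Gaussian marginals with covariances `c`. -/
def HasGaussianMarginals {T : Type*} (Q : Measure (T → ℝ)) (c : T → T → ℝ) : Prop :=
  ∀ I : Finset T, Q.map (fun z => WithLp.toLp 2 (I.restrict z)) =
    multivariateGaussian 0 (kernelMatrix c I)

theorem exists_hasGaussianMarginals {T : Type*} {c : T → T → ℝ}
    (hc : ∀ I : Finset T, (kernelMatrix c I).PosSemidef) :
    ∃ Q : Measure (T → ℝ), IsProbabilityMeasure Q ∧ HasGaussianMarginals Q c := by
  classical
  let P : ∀ I : Finset T, Measure (I → ℝ) := fun I =>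
    (multivariateGaussian 0 (kernelMatrix c I)).map WithLp.ofLp
  have hprob : ∀ I, IsProbabilityMeasure (P I) := fun I =>
    Measure.isProbabilityMeasure_map (by fun_prop)
  have hP : IsProjectiveMeasureFamily (α := fun _ : T => ℝ) P := by
    intro I J hJI
    have h := measurePreserving_restrict₂_multivariateGaussian (μ := 0) (hc I) hJI
    have h0 : (0 : EuclideanSpace ℝ I).restrict₂ hJI = 0 := by ext; simp
    rw [h0] at h
    simp only [P]
    have e : Finset.restrict₂ (π := fun _ => ℝ) hJI ∘ (WithLp.ofLp : EuclideanSpace ℝ I → I → ℝ) =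
        WithLp.ofLp ∘ EuclideanSpace.restrict₂ hJI := by ext; simp
    have h1 := Measure.map_map (μ := multivariateGaussian 0 (kernelMatrix c I))
      (g := Finset.restrict₂ (π := fun _ : T => ℝ) hJI)
      (f := (WithLp.ofLp : EuclideanSpace ℝ I → I → ℝ))
      (Finset.measurable_restrict₂ (X := fun _ : T => ℝ) hJI) (by fun_prop)
    refine Eq.trans ?_ h1.symm
    rw [e, ← Measure.map_map (by fun_prop) (by fun_prop), h.map_eq]
    rfl
  obtain ⟨Q, hQ⟩ := exists_isProjectiveLimit hP
  refine ⟨Q, hQ.isProbabilityMeasure, fun I => ?_⟩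
  have h1 := Measure.map_map (μ := Q) (g := (WithLp.toLp 2 : (I → ℝ) → EuclideanSpace ℝ I))
    (f := I.restrict (π := fun _ : T => ℝ)) (by fun_prop) (Finset.measurable_restrict I)
  refine Eq.trans h1.symm ?_
  rw [hQ I]
  simp only [P]
  rw [Measure.map_map (by fun_prop) (by fun_prop)]
  exact Measure.map_id

namespace HasGaussianMarginals

variable {T : Type*} {Q : Measure (T → ℝ)} {c : T → T → ℝ}

lemma hasGaussianLaw_toLp (h : HasGaussianMarginals Q c) (I : Finset T) :
    HasGaussianLaw (fun z : T → ℝ => WithLp.toLp 2 (I.restrict z)) Q := by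
  classical
  exact ⟨by rw [h I]; infer_instance⟩

lemma isGaussianProcess (h : HasGaussianMarginals Q c) :
    IsGaussianProcess (fun (t : T) (z : T → ℝ) => z t) Q := by
  refine ⟨fun I => ?_⟩
  have := (h.hasGaussianLaw_toLp I).map_equiv (EuclideanSpace.equiv I ℝ)
  exact this

lemma integral_eval (h : HasGaussianMarginals Q c) (t : T) : ∫ z, z t ∂Q = 0 := by
  classical
  have e : ∀ z : T → ℝ, z t = EuclideanSpace.proj (𝕜 := ℝ)
      (⟨t, Finset.mem_singleton_self t⟩ : ({t} : Finset T))
      (WithLp.toLp 2 (({t} : Finset T).restrict z)) := fun z => rfl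
  simp_rw [e]
  rw [← integral_map (φ := fun z : T → ℝ => WithLp.toLp 2 (({t} : Finset T).restrict z))
    (f := fun y => EuclideanSpace.proj (𝕜 := ℝ) _ y) (by fun_prop) (by fun_prop), h {t},
    ContinuousLinearMap.integral_comp_id_comm]
  · simp
  · exact IsGaussian.integrable_id

lemma covariance_eval (h : HasGaussianMarginals Q c)
    (hc : ∀ I : Finset T, (kernelMatrix c I).PosSemidef) (s t : T) :
    cov[fun z : T → ℝ => z s, fun z : T → ℝ => z t; Q] = c s t := by
  classical
  have hm : AEMeasurable (fun z : T → ℝ => WithLp.toLp 2 (({s, t} : Finset T).restrict z)) Q := by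
    fun_prop
  have := covariance_eval_multivariateGaussian (μ := 0) (hc {s, t})
    ⟨s, by simp⟩ ⟨t, by simp⟩
  rw [← h {s, t}, covariance_map (by fun_prop) (by fun_prop) hm] at this
  exact this

end HasGaussianMarginals

/-- Convergence of the characteristic functions of all linear combinations implies convergence of
the finite-dimensional distributions. -/
theorem fidisTendsto_of_tendsto_cexp {Ω : ℕ → Type*} [∀ n, MeasurableSpace (Ω n)]
    {μ : ∀ n, Measure (Ω n)} [∀ n, IsProbabilityMeasure (μ n)] {T : Type*}
    {W : ∀ n, T → Ω n → ℝ} (hW : ∀ n t, Measurable (W n t))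
    {Q : Measure (T → ℝ)} [IsProbabilityMeasure Q] {c : T → T → ℝ}
    (hc : ∀ I : Finset T, (kernelMatrix c I).PosSemidef) (hQ : HasGaussianMarginals Q c)
    (h : ∀ (I : Finset T) (u : I → ℝ),
      Tendsto (fun n => ∫ ω, Complex.exp (Complex.I * ((∑ t, u t * W n t ω : ℝ) : ℂ)) ∂(μ n)) atTop
        (𝓝 (Complex.exp (-((∑ t, ∑ t', u t * u t' * c t t' : ℝ) : ℂ) / 2)))) :
    FidisTendsto μ W Q := by
  classical
  intro I
  have hm : ∀ n, Measurable fun ω => WithLp.toLp 2 (I.restrict fun t => W n t ω) := fun n => by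
    refine (WithLp.measurable_toLp 2 (I → ℝ)).comp (measurable_pi_lambda _ fun t => hW n t)
  have hQm : AEMeasurable (fun z : T → ℝ => WithLp.toLp 2 (I.restrict z)) Q := by fun_prop
  have key : TendstoInDistribution (fun n ω => WithLp.toLp 2 (I.restrict fun t => W n t ω)) atTop
      (fun z : T → ℝ => WithLp.toLp 2 (I.restrict z)) μ Q := by
    refine ⟨fun n => (hm n).aemeasurable, hQm, ?_⟩
    refine ProbabilityMeasure.tendsto_of_tendsto_charFun fun u => ?_
    simp only [ProbabilityMeasure.coe_mk]
    rw [hQ I, charFun_multivariateGaussian (hc I)]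
    convert h I u using 2 with n
    · rw [charFun_apply, integral_map (hm n).aemeasurable (by fun_prop)]
      congr with ω
      rw [mul_comm Complex.I]
      simp [PiLp.inner_apply, Finset.restrict]
    · congr 2
      simp only [dotProduct, Matrix.mulVec, Finset.mul_sum, inner_zero_right, Matrix.of_apply,
        Complex.ofReal_zero, zero_mul, zero_sub, Complex.ofReal_sum, Complex.ofReal_mul, neg_div]
      congr 2
      exact Finset.sum_congr rfl fun i _ => Finset.sum_congr rfl fun j _ => by ring
  exact key.continuous_comp (g := WithLp.ofLp) (by fun_prop)

/-! ### Covariance inequalities under absolute regularity -/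

section Mixing

variable {Ω : Type*} {𝒜 ℬ : MeasurableSpace Ω} [mΩ : MeasurableSpace Ω] {P : Measure Ω}
  [IsProbabilityMeasure P]

lemma enorm_setIntegral_sub_le {F : Ω → ℝ} {h : Ω → ℝ≥0∞} (h𝒜 : 𝒜 ≤ mΩ) (hℬ : ℬ ≤ mΩ)
    (hF : Measurable[𝒜] F) (hF1 : ∀ ω, |F ω| ≤ 1) {B : Set Ω} (hB : MeasurableSet[ℬ] B)
    (hh : ∀ᵐ ω ∂P, ‖(P⟦B | 𝒜⟧) ω - P.real B‖ₑ ≤ h ω) :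
    ‖∫ ω in B, F ω ∂P - P.real B * ∫ ω, F ω ∂P‖ₑ ≤ ∫⁻ ω, h ω ∂P := by
  have hB' : MeasurableSet B := hℬ _ hB
  have hFm : Measurable F := hF.mono h𝒜 le_rfl
  have hFi : Integrable F P := .of_bound hFm.aestronglyMeasurable 1 (ae_of_all _ hF1)
  have hone : Integrable (B.indicator fun _ => (1 : ℝ)) P := (integrable_const 1).indicator hB'
  have hprod : F * B.indicator (fun _ => (1 : ℝ)) = B.indicator F := by
    ext ω; by_cases hω : ω ∈ B <;> simp [hω]
  have hpull : P[F * B.indicator (fun _ => (1 : ℝ)) | 𝒜] =ᵐ[P] F * P⟦B | 𝒜⟧ :=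
    condExp_mul_of_stronglyMeasurable_left hF.stronglyMeasurable
      (by rw [hprod]; exact hFi.indicator hB') hone
  have hI : ∫ ω in B, F ω ∂P = ∫ ω, F ω * (P⟦B | 𝒜⟧) ω ∂P := by
    rw [← integral_indicator hB', ← hprod, ← integral_condExp h𝒜]
    exact integral_congr_ae hpull
  have hFc : Integrable (fun ω => F ω * (P⟦B | 𝒜⟧) ω) P :=
    (integrable_congr hpull).1 integrable_condExp
  have hdiff : ∫ ω in B, F ω ∂P - P.real B * ∫ ω, F ω ∂P =
      ∫ ω, F ω * ((P⟦B | 𝒜⟧) ω - P.real B) ∂P := by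
    simp_rw [mul_sub]
    rw [integral_sub hFc (hFi.mul_const _), integral_mul_const, hI, mul_comm (P.real B)]
  rw [hdiff]
  refine (enorm_integral_le_lintegral_enorm _).trans (lintegral_mono_ae ?_)
  filter_upwards [hh] with ω hω
  rw [enorm_mul]
  refine (mul_le_of_le_one_left zero_le ?_).trans hω
  rw [Real.enorm_eq_ofReal_abs, ENNReal.ofReal_le_one]
  exact hF1 ω

lemma enorm_integral_mul_sub_le {F f : Ω → ℝ} {h : Ω → ℝ≥0∞} (h𝒜 : 𝒜 ≤ mΩ) (hℬ : ℬ ≤ mΩ)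
    (hF : Measurable[𝒜] F) (hF1 : ∀ ω, |F ω| ≤ 1) (hf : Measurable[ℬ] f) (hf1 : ∀ ω, |f ω| ≤ 1)
    (hh : ∀ B : Set Ω, MeasurableSet[ℬ] B → ∀ᵐ ω ∂P, ‖(P⟦B | 𝒜⟧) ω - P.real B‖ₑ ≤ h ω) :
    ‖∫ ω, F ω * f ω ∂P - (∫ ω, F ω ∂P) * ∫ ω, f ω ∂P‖ₑ ≤ 2 * ∫⁻ ω, h ω ∂P := by
  have hFm : Measurable F := hF.mono h𝒜 le_rfl
  have hfm : Measurable f := hf.mono hℬ le_rfl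
  have hFi : Integrable F P := .of_bound hFm.aestronglyMeasurable 1 (ae_of_all _ hF1)
  have hfi : Integrable f P := .of_bound hfm.aestronglyMeasurable 1 (ae_of_all _ hf1)
  have hFfi : Integrable (fun ω => F ω * f ω) P :=
    hfi.bdd_mul hFm.aestronglyMeasurable (ae_of_all _ hF1)
  set a := ∫ ω, F ω ∂P with ha
  let G : Ω → ℝ := fun ω => (P[F | ℬ]) ω - a
  have hGm : StronglyMeasurable[ℬ] G := stronglyMeasurable_condExp.sub stronglyMeasurable_const
  have hGi : Integrable G P := integrable_condExp.sub (integrable_const a)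
  have hGB : ∀ B : Set Ω, MeasurableSet[ℬ] B → ‖∫ ω in B, G ω ∂P‖ₑ ≤ ∫⁻ ω, h ω ∂P := by
    intro B hB
    have : ∫ ω in B, G ω ∂P = ∫ ω in B, F ω ∂P - P.real B * a := by
      simp only [G]
      rw [integral_sub integrable_condExp.integrableOn (integrable_const a).integrableOn,
        setIntegral_condExp hℬ hFi hB]
      simp
    rw [this]
    exact enorm_setIntegral_sub_le h𝒜 hℬ hF hF1 hB (hh B hB)
  have hpull : P[fun ω => F ω * f ω | ℬ] =ᵐ[P] fun ω => (P[F | ℬ]) ω * f ω :=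
    condExp_mul_of_stronglyMeasurable_right hf.stronglyMeasurable hFfi hFi
  have hci : Integrable (fun ω => (P[F | ℬ]) ω * f ω) P :=
    (integrable_congr hpull).1 integrable_condExp
  have hcov : ∫ ω, F ω * f ω ∂P - a * ∫ ω, f ω ∂P = ∫ ω, G ω * f ω ∂P := by
    simp only [G, sub_mul]
    rw [integral_sub hci (hfi.const_mul a), integral_const_mul, ← integral_condExp hℬ,
      integral_congr_ae hpull]
  rw [hcov]
  let B : Set Ω := {ω | 0 ≤ G ω}
  have hB : MeasurableSet[ℬ] B := hGm.measurable measurableSet_Ici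
  have hle : ∫⁻ ω, ‖G ω‖ₑ ∂P ≤ 2 * ∫⁻ ω, h ω ∂P := by
    rw [← lintegral_add_compl _ (hℬ _ hB), two_mul]
    refine add_le_add ?_ ?_
    · refine le_trans (le_of_eq ?_) (hGB B hB)
      rw [← ofReal_integral_norm_eq_lintegral_enorm hGi.integrableOn, Real.enorm_eq_ofReal_abs,
        setIntegral_congr_fun (g := G) (hℬ _ hB) fun ω hω => ?_, abs_of_nonneg]
      · exact setIntegral_nonneg (hℬ _ hB) fun ω hω => hω
      · exact Real.norm_of_nonneg hω
    · refine le_trans (le_of_eq ?_) (hGB Bᶜ hB.compl)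
      rw [← ofReal_integral_norm_eq_lintegral_enorm hGi.integrableOn, Real.enorm_eq_ofReal_abs,
        setIntegral_congr_fun (g := fun ω => -G ω) (hℬ _ hB).compl fun ω hω => ?_, integral_neg,
        abs_of_nonpos]
      · exact setIntegral_nonpos (hℬ _ hB).compl fun ω hω => (not_le.1 (show ¬ 0 ≤ G ω from hω)).le
      · exact Real.norm_of_nonpos (not_le.1 (show ¬ 0 ≤ G ω from hω)).le
  refine ((enorm_integral_le_lintegral_enorm _).trans (lintegral_mono fun ω => ?_)).trans hle
  rw [enorm_mul]
  refine mul_le_of_le_one_right zero_le ?_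
  rw [Real.enorm_eq_ofReal_abs, ENNReal.ofReal_le_one]
  exact hf1 ω

/-- Covariance inequality for complex-valued functions bounded by `1`. -/
lemma enorm_integral_mul_sub_le_betaCoeff {F f : Ω → ℂ} (h𝒜 : 𝒜 ≤ mΩ) (hℬ : ℬ ≤ mΩ)
    (hF : Measurable[𝒜] F) (hF1 : ∀ ω, ‖F ω‖ ≤ 1) (hf : Measurable[ℬ] f) (hf1 : ∀ ω, ‖f ω‖ ≤ 1) :
    ‖∫ ω, F ω * f ω ∂P - (∫ ω, F ω ∂P) * ∫ ω, f ω ∂P‖ₑ ≤ 8 * betaCoeff P 𝒜 ℬ := by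
  have h8 : (8 : ℝ≥0∞) ≠ 0 := by norm_num
  rw [mul_comm (8 : ℝ≥0∞), ← ENNReal.div_le_iff h8 (by norm_num)]
  refine le_iInf fun h => le_iInf fun _ => le_iInf fun hh => ?_
  rw [ENNReal.div_le_iff h8 (by norm_num), mul_comm _ (8 : ℝ≥0∞)]
  have hFi : Integrable F P :=
    .of_bound (hF.mono h𝒜 le_rfl).aestronglyMeasurable 1 (ae_of_all _ hF1)
  have hfi : Integrable f P :=
    .of_bound (hf.mono hℬ le_rfl).aestronglyMeasurable 1 (ae_of_all _ hf1)
  have hFre : Measurable[𝒜] fun ω => (F ω).re := Complex.measurable_re.comp hF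
  have hFim : Measurable[𝒜] fun ω => (F ω).im := Complex.measurable_im.comp hF
  have hfre : Measurable[ℬ] fun ω => (f ω).re := Complex.measurable_re.comp hf
  have hfim : Measurable[ℬ] fun ω => (f ω).im := Complex.measurable_im.comp hf
  have bFre : ∀ ω, |(F ω).re| ≤ 1 := fun ω => (Complex.abs_re_le_norm _).trans (hF1 ω)
  have bFim : ∀ ω, |(F ω).im| ≤ 1 := fun ω => (Complex.abs_im_le_norm _).trans (hF1 ω)
  have bfre : ∀ ω, |(f ω).re| ≤ 1 := fun ω => (Complex.abs_re_le_norm _).trans (hf1 ω)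
  have bfim : ∀ ω, |(f ω).im| ≤ 1 := fun ω => (Complex.abs_im_le_norm _).trans (hf1 ω)
  have e1 := enorm_integral_mul_sub_le h𝒜 hℬ hFre bFre hfre bfre hh
  have e2 := enorm_integral_mul_sub_le h𝒜 hℬ hFim bFim hfim bfim hh
  have e3 := enorm_integral_mul_sub_le h𝒜 hℬ hFre bFre hfim bfim hh
  have e4 := enorm_integral_mul_sub_le h𝒜 hℬ hFim bFim hfre bfre hh
  have hmi : ∀ {u v : Ω → ℝ}, Measurable[𝒜] u → (∀ ω, |u ω| ≤ 1) → Measurable[ℬ] v →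
      (∀ ω, |v ω| ≤ 1) → Integrable (fun ω => u ω * v ω) P := fun hu bu hv bv =>
    (Integrable.of_bound (hv.mono hℬ le_rfl).aestronglyMeasurable 1 (ae_of_all _ bv)).bdd_mul
      (hu.mono h𝒜 le_rfl).aestronglyMeasurable (ae_of_all _ bu)
  have i1 := hmi hFre bFre hfre bfre
  have i2 := hmi hFim bFim hfim bfim
  have i3 := hmi hFre bFre hfim bfim
  have i4 := hmi hFim bFim hfre bfre
  have hFfi : Integrable (fun ω => F ω * f ω) P :=
    hfi.bdd_mul (hF.mono h𝒜 le_rfl).aestronglyMeasurable (ae_of_all _ hF1)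
  have reI : ∀ {u : Ω → ℂ}, Integrable u P → (∫ ω, u ω ∂P).re = ∫ ω, (u ω).re ∂P :=
    fun hu => (integral_re hu).symm
  have imI : ∀ {u : Ω → ℂ}, Integrable u P → (∫ ω, u ω ∂P).im = ∫ ω, (u ω).im ∂P :=
    fun hu => (integral_im hu).symm
  have key : ∫ ω, F ω * f ω ∂P - (∫ ω, F ω ∂P) * ∫ ω, f ω ∂P =
      (((∫ ω, (F ω).re * (f ω).re ∂P - (∫ ω, (F ω).re ∂P) * ∫ ω, (f ω).re ∂P : ℝ) : ℂ) -
      ((∫ ω, (F ω).im * (f ω).im ∂P - (∫ ω, (F ω).im ∂P) * ∫ ω, (f ω).im ∂P : ℝ) : ℂ)) +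
      Complex.I * (((∫ ω, (F ω).re * (f ω).im ∂P - (∫ ω, (F ω).re ∂P) * ∫ ω, (f ω).im ∂P : ℝ) : ℂ) +
      ((∫ ω, (F ω).im * (f ω).re ∂P - (∫ ω, (F ω).im ∂P) * ∫ ω, (f ω).re ∂P : ℝ) : ℂ)) := by
    apply Complex.ext
    · simp only [Complex.sub_re, Complex.mul_re, Complex.add_re, Complex.ofReal_re, Complex.I_re,
        Complex.I_im, Complex.add_im, Complex.ofReal_im, reI hFfi, reI hFi, reI hfi, imI hFi,
        imI hfi]
      rw [integral_sub i1 i2]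
      ring
    · simp only [Complex.sub_im, Complex.mul_im, Complex.add_re, Complex.ofReal_re, Complex.I_re,
        Complex.I_im, Complex.add_im, Complex.ofReal_im, imI hFfi, reI hFi, reI hfi, imI hFi,
        imI hfi]
      rw [integral_add i3 i4]
      ring
  have hof : ∀ x : ℝ, ‖(x : ℂ)‖ₑ = ‖x‖ₑ := fun x => by
    rw [← ofReal_norm, Complex.norm_real, ofReal_norm]
  rw [key]
  refine (enorm_add_le _ _).trans ?_
  rw [enorm_mul]
  have hI : ‖Complex.I‖ₑ = 1 := by rw [← ofReal_norm]; simp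
  rw [hI, one_mul]
  calc _ ≤ (2 * ∫⁻ ω, h ω ∂P + 2 * ∫⁻ ω, h ω ∂P) + (2 * ∫⁻ ω, h ω ∂P + 2 * ∫⁻ ω, h ω ∂P) := by
        refine add_le_add ((enorm_sub_le).trans ?_) ((enorm_add_le _ _).trans ?_)
        · rw [hof, hof]; exact add_le_add e1 e2
        · rw [hof, hof]; exact add_le_add e3 e4
    _ = 8 * ∫⁻ ω, h ω ∂P := by ring

end Mixing

/-- Telescoping: if each factor can be split off at cost `c`, then the expectation of a product of
`k` factors bounded by `1` differs by at most `k c` from the product of the expectations. -/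
lemma enorm_integral_prod_sub_prod_le {Ω : Type*} [MeasurableSpace Ω] {P : Measure Ω}
    [IsProbabilityMeasure P] {f : ℕ → Ω → ℂ} (hf : ∀ i ω, ‖f i ω‖ ≤ 1) {c : ℝ≥0∞} (k : ℕ)
    (h : ∀ i, 1 ≤ i → i < k →
      ‖∫ ω, (∏ j ∈ Finset.range i, f j ω) * f i ω ∂P -
        (∫ ω, ∏ j ∈ Finset.range i, f j ω ∂P) * ∫ ω, f i ω ∂P‖ₑ ≤ c) :
    ‖∫ ω, ∏ j ∈ Finset.range k, f j ω ∂P - ∏ j ∈ Finset.range k, ∫ ω, f j ω ∂P‖ₑ ≤ k * c := by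
  induction k with
  | zero => simp
  | succ k ih =>
    rcases Nat.eq_zero_or_pos k with rfl | hk
    · simp
    have ih' := ih fun i h1 h2 => h i h1 (by lia)
    have hk' := h k hk (by lia)
    simp only [Finset.prod_range_succ]
    set A := ∫ ω, (∏ j ∈ Finset.range k, f j ω) * f k ω ∂P
    set B := ∫ ω, ∏ j ∈ Finset.range k, f j ω ∂P
    set e := ∫ ω, f k ω ∂P with he
    set D := ∏ j ∈ Finset.range k, ∫ ω, f j ω ∂P
    have hfe : ‖e‖ₑ ≤ 1 := by
      rw [← ofReal_norm, ENNReal.ofReal_le_one]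
      simpa using norm_integral_le_of_norm_le_const (μ := P) (ae_of_all _ (hf k))
    have : A - D * e = (B - D) * e + (A - B * e) := by ring
    rw [this]
    push_cast
    rw [add_mul, one_mul]
    refine (enorm_add_le _ _).trans (add_le_add ?_ hk')
    rw [enorm_mul]
    exact (mul_le_of_le_one_right zero_le hfe).trans ih'

/-! ### A central limit theorem for characteristic functions -/

lemma sq_integral_mul_le {Ω : Type*} [MeasurableSpace Ω] {P : Measure Ω} {X Y : Ω → ℝ}
    (hX : Integrable (fun ω => X ω ^ 2) P) (hY : Integrable (fun ω => Y ω ^ 2) P)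
    (hXY : Integrable (fun ω => X ω * Y ω) P) :
    (∫ ω, X ω * Y ω ∂P) ^ 2 ≤ (∫ ω, X ω ^ 2 ∂P) * ∫ ω, Y ω ^ 2 ∂P := by
  have h : ∀ t : ℝ, 0 ≤ (∫ ω, Y ω ^ 2 ∂P) * (t * t) + (2 * ∫ ω, X ω * Y ω ∂P) * t +
      ∫ ω, X ω ^ 2 ∂P := by
    intro t
    have : ∫ ω, (t * Y ω + X ω) ^ 2 ∂P = (∫ ω, Y ω ^ 2 ∂P) * (t * t) +
        (2 * ∫ ω, X ω * Y ω ∂P) * t + ∫ ω, X ω ^ 2 ∂P := by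
      have e : ∀ ω, (t * Y ω + X ω) ^ 2 = Y ω ^ 2 * (t * t) + X ω * Y ω * (2 * t) + X ω ^ 2 :=
        fun ω => by ring
      simp_rw [e]
      rw [integral_add ((hY.mul_const _).fun_add (hXY.mul_const _)) hX,
        integral_add (hY.mul_const _) (hXY.mul_const _), integral_mul_const, integral_mul_const]
      ring
    rw [← this]
    exact integral_nonneg fun ω => sq_nonneg _
  have := discrim_le_zero h
  unfold discrim at this
  nlinarith

lemma norm_pow_sub_pow_le {a b : ℂ} (ha : ‖a‖ ≤ 1) (hb : ‖b‖ ≤ 1) (k : ℕ) :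
    ‖a ^ k - b ^ k‖ ≤ k * ‖a - b‖ := by
  induction k with
  | zero => simp
  | succ k ih =>
    have e : a ^ (k + 1) - b ^ (k + 1) = (a ^ k - b ^ k) * a + b ^ k * (a - b) := by ring
    rw [e]
    refine (norm_add_le _ _).trans ?_
    rw [norm_mul, norm_mul, norm_pow]
    push_cast
    have h1 : ‖a ^ k - b ^ k‖ * ‖a‖ ≤ k * ‖a - b‖ :=
      (mul_le_of_le_one_right (norm_nonneg _) ha).trans ih
    have h2 : ‖b‖ ^ k * ‖a - b‖ ≤ ‖a - b‖ :=
      mul_le_of_le_one_left (norm_nonneg _) (pow_le_one₀ (norm_nonneg _) hb)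
    linarith

lemma tendsto_pow_of_tendsto_mul_sub_one {m : ℕ → ℕ} (hm : Tendsto m atTop atTop) {z : ℕ → ℂ}
    (hz : ∀ n, ‖z n‖ ≤ 1) {t : ℝ} (ht : t ≤ 0)
    (h : Tendsto (fun n => (m n : ℂ) * (z n - 1)) atTop (𝓝 t)) :
    Tendsto (fun n => z n ^ m n) atTop (𝓝 (Complex.exp t)) := by
  have hmR : Tendsto (fun n => (m n : ℝ)) atTop atTop := tendsto_natCast_atTop_atTop.comp hm
  let w : ℕ → ℂ := fun n => Complex.exp ((t / m n : ℝ) : ℂ)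
  have hw1 : ∀ n, ‖w n‖ ≤ 1 := fun n => by
    simp only [w, Complex.norm_exp, Complex.ofReal_re, Real.exp_le_one_iff]
    exact div_nonpos_of_nonpos_of_nonneg ht (Nat.cast_nonneg _)
  have hsmall : Tendsto (fun n => |t| / (m n : ℝ)) atTop (𝓝 0) := tendsto_const_nhds.div_atTop hmR
  have hw : Tendsto (fun n => (m n : ℂ) * (w n - 1)) atTop (𝓝 t) := by
    rw [tendsto_iff_norm_sub_tendsto_zero]
    have hlim : Tendsto (fun n => |t| * (|t| / (m n : ℝ))) atTop (𝓝 0) := by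
      simpa using hsmall.const_mul |t|
    refine squeeze_zero' (Eventually.of_forall fun n => norm_nonneg _) ?_ hlim
    filter_upwards [hm.eventually_ge_atTop 1, hsmall.eventually (eventually_le_nhds one_pos)]
      with n hn hn1
    have hmpos : (0 : ℝ) < m n := by exact_mod_cast hn
    have hnorm : ‖((t / m n : ℝ) : ℂ)‖ = |t| / m n := by
      rw [Complex.norm_real, Real.norm_eq_abs, abs_div, abs_of_pos hmpos]
    have h1 := Complex.norm_exp_sub_one_sub_id_le (x := ((t / m n : ℝ) : ℂ))
      (by rw [hnorm]; exact hn1)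
    have e : (m n : ℂ) * (w n - 1) - t = (m n : ℂ) * (w n - 1 - ((t / m n : ℝ) : ℂ)) := by
      have : (m n : ℂ) ≠ 0 := by exact_mod_cast hmpos.ne'
      push_cast
      field_simp
    rw [e, norm_mul, Complex.norm_natCast]
    calc (m n : ℝ) * ‖w n - 1 - ((t / m n : ℝ) : ℂ)‖ ≤ m n * (|t| / m n) ^ 2 := by
          rw [← hnorm]; gcongr
      _ = |t| * (|t| / m n) := by field_simp
  have hwm : ∀ᶠ n in atTop, w n ^ m n = Complex.exp t := by
    filter_upwards [hm.eventually_ge_atTop 1] with n hn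
    have : (m n : ℂ) ≠ 0 := by exact_mod_cast (by lia : m n ≠ 0)
    simp only [w]
    rw [← Complex.exp_nat_mul]
    congr 1
    push_cast
    field_simp
  have hdiff : Tendsto (fun n => z n ^ m n - w n ^ m n) atTop (𝓝 0) := by
    have h0 := (h.sub hw).norm
    rw [sub_self, norm_zero] at h0
    refine squeeze_zero_norm (fun n => ?_) h0
    refine (norm_pow_sub_pow_le (hz n) (hw1 n) (m n)).trans (le_of_eq ?_)
    rw [← Complex.norm_natCast, ← norm_mul]
    congr 1
    ring
  have := hdiff.add (tendsto_const_nhds.congr' (hwm.mono fun n hn => hn.symm))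
  simpa using this

lemma norm_integral_cexp_sub_le {Ω : Type*} [MeasurableSpace Ω] {P : Measure Ω}
    [IsProbabilityMeasure P] {W : Ω → ℝ} (hW : Measurable W) {δ : ℝ} (hδ : δ ≤ 1)
    (hWδ : ∀ ω, |W ω| ≤ δ) (h0 : ∫ ω, W ω ∂P = 0) :
    ‖∫ ω, Complex.exp (Complex.I * (W ω : ℂ)) ∂P - 1 + ((∫ ω, W ω ^ 2 ∂P : ℝ) : ℂ) / 2‖ ≤
      δ * ∫ ω, W ω ^ 2 ∂P := by
  have hW2 : Integrable (fun ω => W ω ^ 2) P := by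
    refine .of_bound (by fun_prop) (δ ^ 2) (ae_of_all _ fun ω => ?_)
    rw [Real.norm_eq_abs, abs_pow]
    exact pow_le_pow_left₀ (abs_nonneg _) (hWδ ω) 2
  have hWi : Integrable W P := .of_bound (by fun_prop) δ (ae_of_all _ hWδ)
  have hexp : Integrable (fun ω => Complex.exp (Complex.I * (W ω : ℂ))) P :=
    .of_bound (by fun_prop) 1 (ae_of_all _ fun ω => (Complex.norm_exp_I_mul_ofReal _).le)
  have e : ∫ ω, Complex.exp (Complex.I * (W ω : ℂ)) ∂P - 1 + ((∫ ω, W ω ^ 2 ∂P : ℝ) : ℂ) / 2 =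
      ∫ ω, (Complex.exp (Complex.I * (W ω : ℂ)) - 1 - Complex.I * (W ω : ℂ) +
        ((W ω ^ 2 : ℝ) : ℂ) / 2) ∂P := by
    have hi : Integrable (fun ω => Complex.I * (W ω : ℂ)) P := hWi.ofReal.const_mul _
    have h1 : Integrable (fun ω => Complex.exp (Complex.I * (W ω : ℂ)) - 1) P :=
      hexp.sub (integrable_const 1)
    have h2 : Integrable (fun ω => Complex.exp (Complex.I * (W ω : ℂ)) - 1 -
        Complex.I * (W ω : ℂ)) P := h1.sub hi
    have h3 : Integrable (fun ω => ((W ω ^ 2 : ℝ) : ℂ) / 2) P := hW2.ofReal.div_const 2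
    rw [integral_add h2 h3, integral_sub h1 hi, integral_sub hexp (integrable_const 1),
      integral_const_mul,
      integral_div, integral_complex_ofReal, integral_complex_ofReal, h0]
    simp
  rw [e, ← integral_const_mul]
  refine norm_integral_le_of_norm_le (hW2.const_mul δ) (ae_of_all _ fun ω => ?_)
  have hn : ‖Complex.I * (W ω : ℂ)‖ = |W ω| := by simp
  have hb := Complex.exp_bound (x := Complex.I * (W ω : ℂ)) (by rw [hn]; exact (hWδ ω).trans hδ)
    (n := 3) (by norm_num)
  have e2 : Complex.exp (Complex.I * (W ω : ℂ)) -
      ∑ k ∈ Finset.range 3, (Complex.I * (W ω : ℂ)) ^ k / (k.factorial : ℂ) =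
      Complex.exp (Complex.I * (W ω : ℂ)) - 1 - Complex.I * (W ω : ℂ) +
        ((W ω ^ 2 : ℝ) : ℂ) / 2 := by
    simp only [Finset.sum_range_succ, Finset.sum_range_zero, Nat.factorial, mul_pow, Complex.I_sq]
    push_cast
    ring
  rw [e2, hn] at hb
  refine hb.trans ?_
  have hc : ((Nat.succ 3 : ℕ) : ℝ) * ((Nat.factorial 3 * (3 : ℕ) : ℝ))⁻¹ ≤ 1 := by
    norm_num [Nat.factorial]
  calc |W ω| ^ 3 * (((Nat.succ 3 : ℕ) : ℝ) * ((Nat.factorial 3 * (3 : ℕ) : ℝ))⁻¹)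
      ≤ |W ω| ^ 3 := mul_le_of_le_one_right (by positivity) hc
    _ = |W ω| * W ω ^ 2 := by rw [pow_succ, sq_abs, mul_comm]
    _ ≤ δ * W ω ^ 2 := by gcongr; exact hWδ ω

section

variable {Ω : ℕ → Type*} [∀ n, MeasurableSpace (Ω n)] {μ : ∀ n, Measure (Ω n)}
  [∀ n, IsProbabilityMeasure (μ n)]

/-- Powers of the characteristic functions of asymptotically negligible centered variables. -/
lemma tendsto_integral_cexp_pow {m : ℕ → ℕ} (hm : Tendsto m atTop atTop) {A : ∀ n, Ω n → ℝ}
    {δ : ℕ → ℝ} (hδ : Tendsto δ atTop (𝓝 0))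
    (hA : ∀ᶠ n in atTop, Measurable (A n) ∧ (∀ ω, |A n ω| ≤ δ n) ∧ ∫ ω, A n ω ∂(μ n) = 0) {v : ℝ}
    (hv : Tendsto (fun n => m n * ∫ ω, A n ω ^ 2 ∂(μ n)) atTop (𝓝 v)) :
    Tendsto (fun n => (∫ ω, Complex.exp (Complex.I * (A n ω : ℂ)) ∂(μ n)) ^ m n) atTop
      (𝓝 (Complex.exp (-(v : ℂ) / 2))) := by
  have hv0 : 0 ≤ v := ge_of_tendsto' hv fun n =>
    mul_nonneg (Nat.cast_nonneg _) (integral_nonneg fun ω => sq_nonneg _)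
  have key : Tendsto (fun n => (m n : ℂ) *
      (∫ ω, Complex.exp (Complex.I * (A n ω : ℂ)) ∂(μ n) - 1)) atTop (𝓝 ((-v / 2 : ℝ) : ℂ)) := by
    have h1 : Tendsto (fun n => (m n : ℂ) *
        (∫ ω, Complex.exp (Complex.I * (A n ω : ℂ)) ∂(μ n) - 1 +
          ((∫ ω, A n ω ^ 2 ∂(μ n) : ℝ) : ℂ) / 2)) atTop (𝓝 0) := by
      have hlim : Tendsto (fun n => δ n * (m n * ∫ ω, A n ω ^ 2 ∂(μ n))) atTop (𝓝 0) := by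
        simpa using hδ.mul hv
      refine squeeze_zero_norm' ?_ hlim
      filter_upwards [hA, hδ.eventually (eventually_le_nhds one_pos)] with n ⟨ha, hb, hc⟩ hn
      rw [norm_mul, Complex.norm_natCast]
      calc _ ≤ (m n : ℝ) * (δ n * ∫ ω, A n ω ^ 2 ∂(μ n)) := by
            gcongr; exact norm_integral_cexp_sub_le ha hn hb hc
        _ = _ := by ring
    have h2 : Tendsto (fun n => ((m n * ∫ ω, A n ω ^ 2 ∂(μ n) : ℝ) : ℂ) / 2) atTop
        (𝓝 ((v : ℂ) / 2)) :=
      ((Complex.continuous_ofReal.tendsto v).comp hv).div_const 2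
    have h3 := h1.sub h2
    convert h3 using 2 with n
    · push_cast; ring
    · push_cast; ring
  have := tendsto_pow_of_tendsto_mul_sub_one hm (fun n => ?_) (by linarith) key
  · simpa using this
  · simpa using norm_integral_le_of_norm_le_const (μ := μ n) (C := 1)
      (ae_of_all _ fun ω => (Complex.norm_exp_I_mul_ofReal (A n ω)).le)

/-- Adding a term whose characteristic function converges to `1` does not change the limit. -/
lemma tendsto_integral_cexp_add {S R : ∀ n, Ω n → ℝ}
    (hm : ∀ᶠ n in atTop, Measurable (S n) ∧ Measurable (R n)) {z : ℂ}
    (hS : Tendsto (fun n => ∫ ω, Complex.exp (Complex.I * (S n ω : ℂ)) ∂(μ n)) atTop (𝓝 z))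
    (hR : Tendsto (fun n => ∫ ω, Complex.exp (Complex.I * (R n ω : ℂ)) ∂(μ n)) atTop (𝓝 1)) :
    Tendsto (fun n => ∫ ω, Complex.exp (Complex.I * ((S n ω + R n ω : ℝ) : ℂ)) ∂(μ n)) atTop
      (𝓝 z) := by
  have hre : Tendsto (fun n => √(2 - 2 * (∫ ω, Complex.exp (Complex.I * (R n ω : ℂ)) ∂(μ n)).re))
      atTop (𝓝 0) := by
    have h1 := (Complex.continuous_re.tendsto _).comp hR
    have h2 := (Real.continuous_sqrt.tendsto _).comp ((h1.const_mul 2).const_sub 2)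
    simpa [Function.comp_def] using h2
  have hdiff : Tendsto (fun n => ∫ ω, Complex.exp (Complex.I * ((S n ω + R n ω : ℝ) : ℂ)) ∂(μ n) -
      ∫ ω, Complex.exp (Complex.I * (S n ω : ℂ)) ∂(μ n)) atTop (𝓝 0) := by
    refine squeeze_zero_norm' ?_ hre
    filter_upwards [hm] with n ⟨hSm, hRm⟩
    have hint : ∀ {X : Ω n → ℝ}, Measurable X →
        Integrable (fun ω => Complex.exp (Complex.I * (X ω : ℂ))) (μ n) := fun hX =>
      .of_bound (by fun_prop) 1 (ae_of_all _ fun ω => (Complex.norm_exp_I_mul_ofReal _).le)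
    let D : Ω n → ℝ := fun ω => ‖Complex.exp (Complex.I * (R n ω : ℂ)) - 1‖
    have hD2 : ∀ ω, D ω ^ 2 = 2 - 2 * (Complex.exp (Complex.I * (R n ω : ℂ))).re := by
      intro ω
      have h1 := Complex.sq_norm (Complex.exp (Complex.I * (R n ω : ℂ)) - 1)
      have h2 := Complex.sq_norm (Complex.exp (Complex.I * (R n ω : ℂ)))
      rw [Complex.norm_exp_I_mul_ofReal, Complex.normSq_apply] at h2
      rw [Complex.normSq_apply] at h1
      simp only [D, h1, Complex.sub_re, Complex.sub_im, Complex.one_re, Complex.one_im]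
      nlinarith
    have hDi : Integrable D (μ n) := ((hint hRm).sub (integrable_const 1)).norm
    have hD2i : Integrable (fun ω => D ω ^ 2) (μ n) := by
      simp_rw [hD2]
      exact (integrable_const _).sub ((hint hRm).re.const_mul 2)
    have hCS := sq_integral_mul_le (P := μ n) (X := D) (Y := fun _ => 1) hD2i (by simp)
      (by simpa using hDi)
    have hID2 : ∫ ω, D ω ^ 2 ∂(μ n) =
        2 - 2 * (∫ ω, Complex.exp (Complex.I * (R n ω : ℂ)) ∂(μ n)).re := by
      simp_rw [hD2]
      have : (∫ ω, Complex.exp (Complex.I * (R n ω : ℂ)) ∂(μ n)).re =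
        ∫ ω, (Complex.exp (Complex.I * (R n ω : ℂ))).re ∂(μ n) := (integral_re (hint hRm)).symm
      have hi : Integrable (fun ω => (Complex.exp (Complex.I * (R n ω : ℂ))).re) (μ n) :=
        (hint hRm).re
      rw [integral_sub (integrable_const _) (hi.const_mul 2), this]
      simp [integral_const_mul]
    simp only [mul_one, one_pow, integral_const, probReal_univ, smul_eq_mul, hID2] at hCS
    rw [← integral_sub (hint (hSm.fun_add hRm)) (hint hSm)]
    refine le_trans ?_ (Real.le_sqrt_of_sq_le hCS)
    refine norm_integral_le_of_norm_le hDi (ae_of_all _ fun ω => le_of_eq ?_)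
    have e : Complex.exp (Complex.I * ((S n ω + R n ω : ℝ) : ℂ)) -
        Complex.exp (Complex.I * (S n ω : ℂ)) =
        Complex.exp (Complex.I * (S n ω : ℂ)) * (Complex.exp (Complex.I * (R n ω : ℂ)) - 1) := by
      rw [mul_sub, ← Complex.exp_add]
      push_cast
      rw [mul_add, mul_one]
    rw [e, norm_mul, Complex.norm_exp_I_mul_ofReal, one_mul]
  simpa using hdiff.add hS

/-- If `A + B` has the limiting variance `v` and `B` is asymptotically negligible, then `A` has the
limiting variance `v`. -/
lemma tendsto_mul_integral_sq_of_add {m : ℕ → ℕ} {A B : ∀ n, Ω n → ℝ} {δ : ℕ → ℝ}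
    (hA : ∀ᶠ n in atTop, Measurable (A n) ∧ ∀ ω, |A n ω| ≤ δ n)
    (hB : ∀ᶠ n in atTop, Measurable (B n) ∧ ∀ ω, |B n ω| ≤ δ n) {v : ℝ}
    (hAB : Tendsto (fun n => m n * ∫ ω, (A n ω + B n ω) ^ 2 ∂(μ n)) atTop (𝓝 v))
    (hB0 : Tendsto (fun n => m n * ∫ ω, B n ω ^ 2 ∂(μ n)) atTop (𝓝 0)) :
    Tendsto (fun n => m n * ∫ ω, A n ω ^ 2 ∂(μ n)) atTop (𝓝 v) := by
  have hcross : Tendsto (fun n => m n * ∫ ω, (A n ω + B n ω) * B n ω ∂(μ n)) atTop (𝓝 0) := by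
    have hlim : Tendsto (fun n => √((m n * ∫ ω, (A n ω + B n ω) ^ 2 ∂(μ n)) *
        (m n * ∫ ω, B n ω ^ 2 ∂(μ n)))) atTop (𝓝 0) := by
      have := (Real.continuous_sqrt.tendsto _).comp (hAB.mul hB0)
      simpa [Function.comp_def] using this
    refine squeeze_zero_norm' ?_ hlim
    filter_upwards [hA, hB] with n ⟨ha, ha'⟩ ⟨hb, hb'⟩
    have hs : ∀ ω, |A n ω + B n ω| ≤ δ n + δ n := fun ω =>
      (abs_add_le _ _).trans (add_le_add (ha' ω) (hb' ω))
    have hs' : ∀ ω, |B n ω| ≤ δ n + δ n := fun ω =>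
      (hb' ω).trans (by linarith [(abs_nonneg _).trans (hb' ω)])
    have hprod : ∀ {X Y : Ω n → ℝ}, Measurable X → Measurable Y → (∀ ω, |X ω| ≤ δ n + δ n) →
        (∀ ω, |Y ω| ≤ δ n + δ n) → Integrable (fun ω => X ω * Y ω) (μ n) := fun hX hY bX bY =>
      (Integrable.of_bound hY.aestronglyMeasurable _ (ae_of_all _ bY)).bdd_mul
        hX.aestronglyMeasurable (ae_of_all _ bX)
    have hCS := sq_integral_mul_le (P := μ n) (X := fun ω => A n ω + B n ω) (Y := B n)
      (by simpa only [sq] using hprod (ha.fun_add hb) (ha.fun_add hb) hs hs)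
      (by simpa only [sq] using hprod hb hb hs' hs') (hprod (ha.fun_add hb) hb hs hs')
    refine Real.abs_le_sqrt ?_
    nlinarith [mul_le_mul_of_nonneg_left hCS (sq_nonneg (m n : ℝ))]
  have := (hAB.sub (hcross.const_mul 2)).add hB0
  simp only [mul_zero, sub_zero, add_zero] at this
  refine this.congr' ?_
  filter_upwards [hA, hB] with n ⟨ha, ha'⟩ ⟨hb, hb'⟩
  have hprod : ∀ {X Y : Ω n → ℝ}, Measurable X → Measurable Y → (∀ ω, |X ω| ≤ δ n) →
      (∀ ω, |Y ω| ≤ δ n) → Integrable (fun ω => X ω * Y ω) (μ n) := fun hX hY bX bY =>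
    (Integrable.of_bound hY.aestronglyMeasurable _ (ae_of_all _ bY)).bdd_mul
      hX.aestronglyMeasurable (ae_of_all _ bX)
  have iAA := hprod ha ha ha' ha'
  have iAB := hprod ha hb ha' hb'
  have iBB := hprod hb hb hb' hb'
  have e1 : ∫ ω, (A n ω + B n ω) ^ 2 ∂(μ n) = ∫ ω, A n ω * A n ω ∂(μ n) +
      2 * ∫ ω, A n ω * B n ω ∂(μ n) + ∫ ω, B n ω * B n ω ∂(μ n) := by
    have e : ∀ ω, (A n ω + B n ω) ^ 2 = A n ω * A n ω + 2 * (A n ω * B n ω) + B n ω * B n ω :=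
      fun ω => by ring
    simp_rw [e]
    rw [integral_add (iAA.fun_add (iAB.const_mul 2)) iBB, integral_add iAA (iAB.const_mul 2),
      integral_const_mul]
  have e2 : ∫ ω, (A n ω + B n ω) * B n ω ∂(μ n) = ∫ ω, A n ω * B n ω ∂(μ n) +
      ∫ ω, B n ω * B n ω ∂(μ n) := by
    simp_rw [add_mul]
    rw [integral_add iAB iBB]
  rw [e1, e2]
  simp only [sq]
  ring

end

/-! ### Sums over sliding blocks -/

section BlockSums

variable {E : Type*} {Ω : ℕ → Type*}

lemma measurable_sigmaMk {ι : Type*} {α : ι → Type*} [∀ i, MeasurableSpace (α i)] (i : ι) :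
    Measurable (Sigma.mk i : α i → Σ i, α i) :=
  measurable_iff_le_map.2 (iInf_le _ i)

lemma measurable_sigmaField [MeasurableSpace E] {Ω₀ : Type*} {ξ : ℕ → Ω₀ → E} {a b i : ℕ}
    (h1 : a ≤ i) (h2 : i ≤ b) :
    Measurable[sigmaField ξ a b] (ξ i) :=
  measurable_iff_comap_le.2
    (le_iSup₂_of_le (f := fun l _ => MeasurableSpace.comap (ξ l) _) i (Finset.mem_Icc.2 ⟨h1, h2⟩)
      le_rfl)

lemma sigmaField_le [MeasurableSpace E] {Ω₀ : Type*} [mΩ : MeasurableSpace Ω₀]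
    {ξ : ℕ → Ω₀ → E} {a b : ℕ}
    (h : ∀ i ∈ Finset.Icc a b, Measurable (ξ i)) : sigmaField ξ a b ≤ mΩ :=
  iSup₂_le fun i hi => measurable_iff_comap_le.1 (h i hi)

lemma measurable_comp_block [MeasurableSpace E] {X : ∀ n, ℕ → Ω n → E} {s : ℕ → ℕ+} {n : ℕ}
    {mΩ : MeasurableSpace (Ω n)}
    {G : Vectors E → ℝ} (hG : Measurable G) {j : ℕ}
    (hX : ∀ i, j ≤ i → i < j + s n → Measurable (X n i)) :
    Measurable fun ω => G (block X s n j ω) :=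
  hG.comp ((measurable_sigmaMk (α := fun k : ℕ+ => Fin k → E) (s n)).comp
    (measurable_pi_lambda _ fun i => hX _ (by lia) (by have := i.2; lia)))

/-- The sum of `G` over the `q` consecutive blocks `Y_{n,h+1}, …, Y_{n,h+q}`. -/
def blockSum (X : ∀ n, ℕ → Ω n → E) (s : ℕ → ℕ+) (n : ℕ) (G : Vectors E → ℝ) (h q : ℕ) (ω : Ω n) :
    ℝ :=
  ∑ j ∈ Finset.range q, G (block X s n (h + j + 1) ω)

variable {X : ∀ n, ℕ → Ω n → E} {s : ℕ → ℕ+} {n : ℕ} {G : Vectors E → ℝ}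

lemma blockSum_add (h q q' : ℕ) (ω : Ω n) :
    blockSum X s n G h (q + q') ω = blockSum X s n G h q ω + blockSum X s n G (h + q) q' ω := by
  simp [blockSum, Finset.sum_range_add, add_assoc]

lemma blockSum_mul (m q : ℕ) (ω : Ω n) :
    blockSum X s n G 0 (m * q) ω = ∑ i ∈ Finset.range m, blockSum X s n G (i * q) q ω := by
  induction m with
  | zero => simp [blockSum]
  | succ m ih => rw [Nat.succ_mul, blockSum_add, ih, Finset.sum_range_succ, zero_add]

lemma blockSum_eq_sum_Icc (N : ℕ) (ω : Ω n) :
    blockSum X s n G 0 N ω = ∑ j ∈ Finset.Icc 1 N, G (block X s n j ω) := by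
  rw [blockSum, ← Finset.sum_image (f := fun j => G (block X s n j ω)) (g := fun j => 0 + j + 1)
    (fun a _ b _ hab => by simpa using hab)]
  congr 1
  ext j
  simp only [Finset.mem_image, Finset.mem_range, Finset.mem_Icc]
  constructor
  · rintro ⟨a, ha, rfl⟩; lia
  · exact fun hj => ⟨j - 1, by lia, by lia⟩

lemma abs_blockSum_le {K : ℝ} (hK : ∀ x, |G x| ≤ K) (h q : ℕ) (ω : Ω n) :
    |blockSum X s n G h q ω| ≤ q * K := by
  refine (Finset.abs_sum_le_sum_abs _ _).trans ?_
  refine (Finset.sum_le_sum fun j _ => hK _).trans ?_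
  simp

lemma measurable_blockSum [MeasurableSpace E] {mΩ : MeasurableSpace (Ω n)} (hG : Measurable G)
    {h q : ℕ}
    (hX : ∀ i, h + 1 ≤ i → i < h + q + s n → Measurable (X n i)) :
    Measurable (blockSum X s n G h q) :=
  Finset.measurable_fun_sum _ fun j hj => by
    have := Finset.mem_range.1 hj
    exact measurable_comp_block hG fun i h1 h2 => hX i (by lia) (by lia)

lemma numBlocks_mul_le (s r : ℕ → ℕ+) (n : ℕ) : numBlocks s r n * r n ≤ n + 1 - s n :=
  Nat.div_mul_le_self _ _

lemma sub_numBlocks_mul_lt (s r : ℕ → ℕ+) (n : ℕ) : n + 1 - s n - numBlocks s r n * r n < r n := by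
  have h1 := Nat.div_add_mod (n + 1 - s n) (r n)
  have h2 := Nat.mod_lt (n + 1 - s n) (r n).pos
  have h3 : (r n : ℕ) * ((n + 1 - s n) / r n) = numBlocks s r n * r n := mul_comm _ _
  lia

variable [MeasurableSpace E] [∀ n, MeasurableSpace (Ω n)] {μ : ∀ n, Measure (Ω n)}

lemma identDistrib_blockSum (hX : ∀ n, ∀ i ∈ Finset.Icc 1 n, Measurable (X n i))
    (hst : ∀ n, IsStationaryRow (μ n) n (X n)) (hG : Measurable G) {h q : ℕ}
    (hq : h + q + s n ≤ n + 1) :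
    IdentDistrib (blockSum X s n G h q) (blockSum X s n G 0 q) (μ n) (μ n) := by
  have hs := (s n).pos
  have hvec : IdentDistrib (fun ω (i : Fin (q + s n - 1)) => X n (h + i + 1) ω)
      (fun ω (i : Fin (q + s n - 1)) => X n (i + 1) ω) (μ n) (μ n) :=
    ⟨(measurable_pi_lambda _ fun i => hX n _ (by have := i.2; simp; lia)).aemeasurable,
      (measurable_pi_lambda _ fun i => hX n _ (by have := i.2; simp; lia)).aemeasurable,
      hst n h (q + s n - 1) (by lia)⟩
  let Φ : (Fin (q + s n - 1) → E) → ℝ := fun x =>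
    ∑ j : Fin q, G ⟨s n, fun i => x ⟨j + i, by have := i.2; have := j.2; lia⟩⟩
  have hΦ : Measurable Φ := Finset.measurable_fun_sum _ fun j _ =>
    hG.comp ((measurable_sigmaMk (α := fun k : ℕ+ => Fin k → E) (s n)).comp
      (measurable_pi_lambda _ fun i => measurable_pi_apply _))
  have e1 : blockSum X s n G h q = Φ ∘ fun ω (i : Fin (q + s n - 1)) => X n (h + i + 1) ω := by
    ext ω
    simp only [blockSum, Φ, Function.comp, block]
    rw [← Fin.sum_univ_eq_sum_range
      (fun j => G ⟨s n, fun i : Fin (s n) => X n (h + j + 1 + i) ω⟩)]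
    refine Finset.sum_congr rfl fun j _ => congrArg G
      (Sigma.ext rfl (heq_of_eq (funext fun i => ?_)))
    exact congrArg (fun k => X n k ω) (show h + (j : ℕ) + 1 + i = h + (j + i) + 1 by lia)
  have e2 : blockSum X s n G 0 q = Φ ∘ fun ω (i : Fin (q + s n - 1)) => X n (i + 1) ω := by
    ext ω
    simp only [blockSum, Φ, Function.comp, block]
    rw [← Fin.sum_univ_eq_sum_range
      (fun j => G ⟨s n, fun i : Fin (s n) => X n (0 + j + 1 + i) ω⟩)]
    refine Finset.sum_congr rfl fun j _ => congrArg G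
      (Sigma.ext rfl (heq_of_eq (funext fun i => ?_)))
    exact congrArg (fun k => X n k ω) (show 0 + (j : ℕ) + 1 + i = j + i + 1 by lia)
  rw [e1, e2]
  exact hvec.comp hΦ

/-- Sums over separated stretches of blocks are nearly independent. -/
lemma enorm_integral_cexp_sum_sub_pow_le [∀ n, IsProbabilityMeasure (μ n)]
    (hX : ∀ n, ∀ i ∈ Finset.Icc 1 n, Measurable (X n i))
    (hst : ∀ n, IsStationaryRow (μ n) n (X n)) (hG : Measurable G) {l r : ℕ → ℕ+}
    (hsl : s n ≤ l n) (hlr : l n ≤ r n) {o q : ℕ} (hq : 1 ≤ q) (hoq : o + q ≤ r n)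
    (hql : q + l n ≤ r n + 1) :
    ‖∫ ω, Complex.exp (Complex.I * ((∑ i ∈ Finset.range (numBlocks s r n),
        blockSum X s n G (i * r n + o) q ω : ℝ) : ℂ)) ∂(μ n) -
      (∫ ω, Complex.exp (Complex.I * (blockSum X s n G 0 q ω : ℂ)) ∂(μ n)) ^ numBlocks s r n‖ₑ ≤
    numBlocks s r n * (8 * betaMixing (μ n) n (X n) (l n - s n : ℕ)) := by
  set m := numBlocks s r n with hm
  have hsl' : (s n : ℕ) ≤ l n := hsl
  have hlr' : (l n : ℕ) ≤ r n := hlr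
  have hs := (s n).pos
  have hmr : ∀ i < m, i * r n + o + q + s n ≤ n + 1 := by
    intro i hi
    have h1 := numBlocks_mul_le s r n
    rw [← hm] at h1
    have h2 : (i + 1) * (r n : ℕ) ≤ m * r n := Nat.mul_le_mul_right _ hi
    rw [Nat.succ_mul] at h2
    have h3 := (r n).pos
    lia
  let f : ℕ → Ω n → ℂ := fun i ω =>
    if i < m then Complex.exp (Complex.I * (blockSum X s n G (i * r n + o) q ω : ℂ)) else 1
  have hf1 : ∀ i ω, ‖f i ω‖ ≤ 1 := by
    intro i ω
    simp only [f]
    split_ifs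
    · exact (Complex.norm_exp_I_mul_ofReal _).le
    · simp
  have hfm : ∀ {mΩ : MeasurableSpace (Ω n)} {i : ℕ}, i < m →
      (∀ j, i * r n + o + 1 ≤ j → j < i * r n + o + q + s n → Measurable (X n j)) →
      Measurable (f i) := by
    intro mΩ i hi hj
    simp only [f, hi, if_true]
    have := measurable_blockSum (X := X) (s := s) hG hj
    fun_prop
  have key := enorm_integral_prod_sub_prod_le (P := μ n) hf1 m
    (c := 8 * betaMixing (μ n) n (X n) (l n - s n : ℕ)) ?_
  · have e1 : ∀ ω, Complex.exp (Complex.I * ((∑ i ∈ Finset.range m,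
        blockSum X s n G (i * r n + o) q ω : ℝ) : ℂ)) = ∏ i ∈ Finset.range m, f i ω := by
      intro ω
      push_cast
      rw [Finset.mul_sum, Complex.exp_sum]
      refine Finset.prod_congr rfl fun i hi => ?_
      simp [f, Finset.mem_range.1 hi]
    have e2 : ∏ i ∈ Finset.range m, ∫ ω, f i ω ∂(μ n) =
        (∫ ω, Complex.exp (Complex.I * (blockSum X s n G 0 q ω : ℂ)) ∂(μ n)) ^ m := by
      rw [← Finset.card_range m, ← Finset.prod_const, Finset.card_range]
      refine Finset.prod_congr rfl fun i hi => ?_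
      simp only [f, Finset.mem_range.1 hi, if_true]
      have hid := identDistrib_blockSum hX hst hG (hmr i (Finset.mem_range.1 hi))
      exact (hid.comp (u := fun x : ℝ => Complex.exp (Complex.I * (x : ℂ)))
        (by fun_prop)).integral_eq
    simp_rw [e1, ← e2]
    exact key
  · intro i h1 hi
    have hir : (r n : ℕ) ≤ i * r n := Nat.le_mul_of_pos_left _ h1
    let L := i * r n + o - (l n - s n)
    have hL : L + (l n - s n) + 1 = i * r n + o + 1 := by lia
    have hbound := hmr i hi
    have hq0 : i * (r n : ℕ) + o + 1 ≤ n := by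
      have h3 := numBlocks_mul_le s r n
      rw [← hm] at h3
      have h2 : (i + 1) * (r n : ℕ) ≤ m * r n := Nat.mul_le_mul_right _ hi
      rw [Nat.succ_mul] at h2
      have h4 := (r n).pos
      lia
    have hle : betaCoeff (μ n) (sigmaField (X n) 1 L) (sigmaField (X n) (L + (l n - s n) + 1) n) ≤
        betaMixing (μ n) n (X n) (l n - s n : ℕ) :=
      le_iSup₂_of_le (f := fun L _ => betaCoeff (μ n) (sigmaField (X n) 1 L)
        (sigmaField (X n) (L + (l n - s n) + 1) n)) L (Finset.mem_Icc.2 (by lia)) le_rfl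
    refine le_trans (enorm_integral_mul_sub_le_betaCoeff (𝒜 := sigmaField (X n) 1 L)
      (ℬ := sigmaField (X n) (L + (l n - s n) + 1) n) ?_ ?_ ?_ ?_ ?_ (hf1 i))
      (mul_le_mul_right hle 8)
    · exact sigmaField_le fun j hj => hX n j (by simp at hj ⊢; lia)
    · exact sigmaField_le fun j hj => hX n j (by simp at hj ⊢; lia)
    · refine Finset.measurable_fun_prod _ fun j hj => ?_
      have hji := Finset.mem_range.1 hj
      have h2 : (j + 1) * (r n : ℕ) ≤ i * r n := Nat.mul_le_mul_right _ hji
      rw [Nat.succ_mul] at h2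
      exact hfm (hji.trans hi) fun k hk1 hk2 => measurable_sigmaField (by lia) (by lia)
    · intro ω
      rw [norm_prod]
      exact Finset.prod_le_one (fun _ _ => norm_nonneg _) fun j _ => hf1 j ω
    · exact hfm hi fun k hk1 hk2 => measurable_sigmaField (by lia) (by lia)

end BlockSums

/-! ### The central limit theorem for sums over big blocks -/

lemma eventually_mul_le_of_isLittleO {a : ℕ → ℕ+} {f : ℕ → ℕ}
    (h : (fun n => (a n : ℝ)) =o[atTop] (fun n => (f n : ℝ))) (C : ℕ) :
    ∀ᶠ n in atTop, C * (a n : ℕ) ≤ f n := by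
  rcases Nat.eq_zero_or_pos C with rfl | hC
  · simp
  have hC' : (0 : ℝ) < C := by exact_mod_cast hC
  filter_upwards [h.bound (inv_pos.2 hC')] with n hn
  rw [Real.norm_of_nonneg (by positivity), Real.norm_of_nonneg (by positivity),
    inv_mul_eq_div, le_div_iff₀ hC', mul_comm] at hn
  exact_mod_cast hn

lemma tendsto_numBlocks {s l r : ℕ → ℕ+} (hsl : ∀ n, s n ≤ l n)
    (hlr : (fun n => (l n : ℝ)) =o[atTop] (fun n => (r n : ℝ)))
    (hrn : (fun n => (r n : ℝ)) =o[atTop] (fun n : ℕ => (n : ℝ))) :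
    Tendsto (numBlocks s r) atTop atTop := by
  refine tendsto_atTop.2 fun C => ?_
  filter_upwards [eventually_mul_le_of_isLittleO (f := fun n => r n) hlr 1,
    eventually_mul_le_of_isLittleO (f := fun n => n) hrn (C + 1)] with n h1 h2
  have h3 : (s n : ℕ) ≤ l n := hsl n
  rw [numBlocks, Nat.le_div_iff_mul_le (r n).pos]
  rw [Nat.succ_mul] at h2
  lia

section

variable {E : Type*} [MeasurableSpace E] {Ω : ℕ → Type*} [∀ n, MeasurableSpace (Ω n)]
  {μ : ∀ n, Measure (Ω n)} [∀ n, IsProbabilityMeasure (μ n)] {X : ∀ n, ℕ → Ω n → E}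
  {s l r : ℕ → ℕ+}

lemma integral_blockSum_eq (hX : ∀ n, ∀ i ∈ Finset.Icc 1 n, Measurable (X n i))
    (hst : ∀ n, IsStationaryRow (μ n) n (X n)) {n : ℕ} {G : Vectors E → ℝ} (hG : Measurable G)
    {K : ℝ} (hK : ∀ x, |G x| ≤ K) {q : ℕ} (hq : q + s n ≤ n + 1) :
    ∫ ω, blockSum X s n G 0 q ω ∂(μ n) = q * ∫ ω, G (block X s n 1 ω) ∂(μ n) := by
  simp only [blockSum]
  have hone : ∀ h ω, blockSum X s n G h 1 ω = G (block X s n (h + 1) ω) := fun h ω => by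
    simp [blockSum]
  rw [integral_finsetSum]
  · rw [Finset.sum_congr rfl fun j hj => ?_, Finset.sum_const, Finset.card_range, nsmul_eq_mul]
    have hj' := Finset.mem_range.1 hj
    have h := (identDistrib_blockSum hX hst hG (h := j) (q := 1) (s := s) (n := n)
      (by lia)).integral_eq
    simp only [hone, zero_add] at h
    rw [zero_add]
    exact h
  · intro j hj
    have hj' := Finset.mem_range.1 hj
    exact .of_bound (measurable_comp_block hG fun i h1 h2 =>
      hX n i (Finset.mem_Icc.2 (by lia))).aestronglyMeasurable K (ae_of_all _ fun ω => hK _)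

/-- The characteristic function of a sum of negligible centered functions over the big blocks. -/
theorem tendsto_integral_cexp_blockSum (hX : ∀ n, ∀ i ∈ Finset.Icc 1 n, Measurable (X n i))
    (hst : ∀ n, IsStationaryRow (μ n) n (X n)) (hsl : ∀ n, s n ≤ l n)
    (hlr : (fun n => (l n : ℝ)) =o[atTop] (fun n => (r n : ℝ)))
    (hrn : (fun n => (r n : ℝ)) =o[atTop] (fun n : ℕ => (n : ℝ)))
    (hMX : Tendsto (fun n => (numBlocks s r n : ℝ≥0∞) *
      betaMixing (μ n) n (X n) (l n - s n : ℕ)) atTop (𝓝 0))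
    {G : ℕ → Vectors E → ℝ} (hG : ∀ n, Measurable (G n)) {K : ℕ → ℝ}
    (hK : ∀ᶠ n in atTop, ∀ x, |G n x| ≤ K n) (hrK : Tendsto (fun n => r n * K n) atTop (𝓝 0))
    (h0 : ∀ᶠ n in atTop, ∫ ω, G n (block X s n 1 ω) ∂(μ n) = 0) {v : ℝ}
    (hv : Tendsto (fun n => numBlocks s r n *
      ∫ ω, blockSum X s n (G n) 0 (r n) ω ^ 2 ∂(μ n)) atTop (𝓝 v))
    (hl : Tendsto (fun n => numBlocks s r n *
      ∫ ω, blockSum X s n (G n) 0 (l n) ω ^ 2 ∂(μ n)) atTop (𝓝 0)) :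
    Tendsto (fun n => ∫ ω, Complex.exp (Complex.I *
      (blockSum X s n (G n) 0 (numBlocks s r n * r n) ω : ℂ)) ∂(μ n)) atTop
      (𝓝 (Complex.exp (-(v : ℂ) / 2))) := by
  have hm := tendsto_numBlocks hsl hlr hrn
  have hev : ∀ᶠ n in atTop, (s n : ℕ) ≤ l n ∧ 2 * (l n : ℕ) ≤ r n ∧ 2 * (r n : ℕ) ≤ n ∧
      (∀ x, |G n x| ≤ K n) ∧ ∫ ω, G n (block X s n 1 ω) ∂(μ n) = 0 := by
    filter_upwards [eventually_mul_le_of_isLittleO (f := fun n => r n) hlr 2,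
      eventually_mul_le_of_isLittleO (f := fun n => n) hrn 2, hK, h0] with n h1 h2 h3 h4
    exact ⟨hsl n, h1, h2, h3, h4⟩
  let A : ∀ n, Ω n → ℝ := fun n => blockSum X s n (G n) 0 (r n - l n)
  let B : ∀ n, Ω n → ℝ := fun n => blockSum X s n (G n) (r n - l n) (l n)
  let B' : ∀ n, Ω n → ℝ := fun n => blockSum X s n (G n) 0 (l n)
  have hmeas : ∀ n h q, h + q + s n ≤ n + 1 → Measurable (blockSum X s n (G n) h q) :=
    fun n h q hq => measurable_blockSum (hG n) fun i h1 h2 => hX n i (Finset.mem_Icc.2 (by lia))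
  have hprop : ∀ n h q, h + q + s n ≤ n + 1 → q ≤ r n → (∀ x, |G n x| ≤ K n) →
      Measurable (blockSum X s n (G n) h q) ∧ ∀ ω, |blockSum X s n (G n) h q ω| ≤ r n * K n := by
    intro n h q hq hqr hKn
    refine ⟨hmeas n h q hq, fun ω => (abs_blockSum_le hKn h q ω).trans ?_⟩
    have hK0 : 0 ≤ K n := (abs_nonneg _).trans (hKn ⟨1, fun _ => X n 0 ω⟩)
    gcongr
  have hA : ∀ᶠ n in atTop, Measurable (A n) ∧ (∀ ω, |A n ω| ≤ r n * K n) ∧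
      ∫ ω, A n ω ∂(μ n) = 0 := by
    filter_upwards [hev] with n ⟨h1, h2, h3, h4, h5⟩
    obtain ⟨ha, hb⟩ := hprop n 0 (r n - l n) (by lia) (by lia) h4
    refine ⟨ha, hb, ?_⟩
    rw [integral_blockSum_eq hX hst (hG n) h4 (by lia), h5, mul_zero]
  have hB' : ∀ᶠ n in atTop, Measurable (B' n) ∧ (∀ ω, |B' n ω| ≤ r n * K n) ∧
      ∫ ω, B' n ω ∂(μ n) = 0 := by
    filter_upwards [hev] with n ⟨h1, h2, h3, h4, h5⟩
    obtain ⟨ha, hb⟩ := hprop n 0 (l n) (by lia) (by lia) h4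
    refine ⟨ha, hb, ?_⟩
    rw [integral_blockSum_eq hX hst (hG n) h4 (by lia), h5, mul_zero]
  have hB : ∀ᶠ n in atTop, Measurable (B n) ∧ ∀ ω, |B n ω| ≤ r n * K n := by
    filter_upwards [hev] with n ⟨h1, h2, h3, h4, h5⟩
    exact hprop n _ _ (by lia) (by lia) h4
  have hBl : Tendsto (fun n => numBlocks s r n * ∫ ω, B n ω ^ 2 ∂(μ n)) atTop (𝓝 0) := by
    refine hl.congr' ?_
    filter_upwards [hev] with n ⟨h1, h2, h3, h4, h5⟩
    have := ((identDistrib_blockSum hX hst (hG n) (h := r n - l n) (q := l n) (s := s) (n := n)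
      (by lia)).comp (u := fun x => x ^ 2) (by fun_prop)).integral_eq
    simp only [Function.comp_def] at this
    simp only [B, this]
  have hAB : Tendsto (fun n => numBlocks s r n * ∫ ω, (A n ω + B n ω) ^ 2 ∂(μ n)) atTop
      (𝓝 v) := by
    refine hv.congr' ?_
    filter_upwards [hev] with n ⟨h1, h2, h3, h4, h5⟩
    have e : ∀ ω, blockSum X s n (G n) 0 (r n) ω = A n ω + B n ω := fun ω => by
      have := blockSum_add (X := X) (s := s) (n := n) (G := G n) 0 (r n - l n) (l n) ω
      rwa [Nat.sub_add_cancel (by lia), zero_add] at this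
    simp_rw [e]
  have hAv := tendsto_mul_integral_sq_of_add (hA.mono fun n h => ⟨h.1, h.2.1⟩) hB hAB hBl
  have hφA := tendsto_integral_cexp_pow hm hrK hA hAv
  have hφB := tendsto_integral_cexp_pow hm hrK hB' hl
  have hprod : ∀ o q : ℕ → ℕ, (∀ᶠ n in atTop, 1 ≤ q n ∧ o n + q n ≤ r n ∧
      q n + l n ≤ (r n : ℕ) + 1) → ∀ {z : ℂ},
      Tendsto (fun n => (∫ ω, Complex.exp (Complex.I *
        (blockSum X s n (G n) 0 (q n) ω : ℂ)) ∂(μ n)) ^ numBlocks s r n) atTop (𝓝 z) →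
      Tendsto (fun n => ∫ ω, Complex.exp (Complex.I * ((∑ i ∈ Finset.range (numBlocks s r n),
        blockSum X s n (G n) (i * r n + o n) (q n) ω : ℝ) : ℂ)) ∂(μ n)) atTop (𝓝 z) := by
    intro o q hoq z hz
    have hlim : Tendsto (fun n => (numBlocks s r n : ℝ≥0∞) *
        (8 * betaMixing (μ n) n (X n) (l n - s n : ℕ))) atTop (𝓝 0) := by
      have := ENNReal.Tendsto.const_mul (a := 8) hMX (Or.inr (by norm_num))
      simp only [mul_zero] at this
      exact this.congr fun n => by ring
    have hd : Tendsto (fun n => ∫ ω, Complex.exp (Complex.I *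
        ((∑ i ∈ Finset.range (numBlocks s r n),
          blockSum X s n (G n) (i * r n + o n) (q n) ω : ℝ) : ℂ)) ∂(μ n) -
        (∫ ω, Complex.exp (Complex.I *
          (blockSum X s n (G n) 0 (q n) ω : ℂ)) ∂(μ n)) ^ numBlocks s r n) atTop (𝓝 0) := by
      rw [tendsto_zero_iff_enorm_tendsto_zero]
      refine tendsto_of_tendsto_of_tendsto_of_le_of_le' tendsto_const_nhds hlim
        (Eventually.of_forall fun _ => zero_le) ?_
      filter_upwards [hev, hoq] with n ⟨h1, h2, h3, h4, h5⟩ ⟨h6, h7, h8⟩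
      exact enorm_integral_cexp_sum_sub_pow_le hX hst (hG n) (hsl n)
        (show (l n : ℕ) ≤ r n by lia) h6 h7 h8
    simpa using hd.add hz
  have hSA := hprod (fun _ => 0) (fun n => r n - l n) (by
    filter_upwards [hev] with n ⟨h1, h2, h3, h4, h5⟩
    have := (l n).pos
    lia) hφA
  have hSB := hprod (fun n => r n - l n) (fun n => l n) (by
    filter_upwards [hev] with n ⟨h1, h2, h3, h4, h5⟩
    have := (l n).pos
    lia) (z := 1) (by simpa using hφB)
  have := tendsto_integral_cexp_add (μ := μ) ?_ hSA hSB
  · refine this.congr' ?_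
    filter_upwards [hev] with n ⟨h1, h2, h3, h4, h5⟩
    have e : ∀ ω, blockSum X s n (G n) 0 (numBlocks s r n * r n) ω =
        ∑ i ∈ Finset.range (numBlocks s r n), blockSum X s n (G n) (i * r n + 0) (r n - l n) ω +
        ∑ i ∈ Finset.range (numBlocks s r n),
          blockSum X s n (G n) (i * r n + (r n - l n)) (l n) ω := fun ω => by
      rw [blockSum_mul, ← Finset.sum_add_distrib]
      refine Finset.sum_congr rfl fun i _ => ?_
      rw [add_zero, ← blockSum_add, Nat.sub_add_cancel (by lia)]
    simp_rw [e]
  · filter_upwards [hev] with n ⟨h1, h2, h3, h4, h5⟩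
    have hi : ∀ i ∈ Finset.range (numBlocks s r n), i * (r n : ℕ) + r n + s n ≤ n + 1 := by
      intro i hi
      have h6 := numBlocks_mul_le s r n
      have h7 : (i + 1) * (r n : ℕ) ≤ numBlocks s r n * r n :=
        Nat.mul_le_mul_right _ (Finset.mem_range.1 hi)
      rw [Nat.succ_mul] at h7
      have := (r n).pos
      lia
    exact ⟨Finset.measurable_fun_sum _ fun i h => hmeas n _ _ (by have := hi i h; lia),
      Finset.measurable_fun_sum _ fun i h => hmeas n _ _ (by have := hi i h; lia)⟩

/-- Short stretches of blocks contribute little to the second moment. -/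
lemma mul_integral_blockSum_sq_le (hX : ∀ n, ∀ i ∈ Finset.Icc 1 n, Measurable (X n i))
    (hst : ∀ n, IsStationaryRow (μ n) n (X n)) {n : ℕ} {H : Vectors E → ℝ} (hH : Measurable H)
    (hH0 : ∀ x, 0 ≤ H x) (hH1 : ∀ x, H x ≤ 1) {k q R : ℕ} (hk : k * q ≤ R) (hR : R + s n ≤ n + 1) :
    k * ∫ ω, blockSum X s n H 0 q ω ^ 2 ∂(μ n) ≤ ∫ ω, blockSum X s n H 0 R ω ^ 2 ∂(μ n) := by
  have hs := (s n).pos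
  have hnn : ∀ h q' ω, 0 ≤ blockSum X s n H h q' ω := fun h q' ω =>
    Finset.sum_nonneg fun j _ => hH0 _
  have hint : ∀ h q', h + q' + s n ≤ n + 1 →
      Integrable (fun ω => blockSum X s n H h q' ω ^ 2) (μ n) := by
    intro h q' hq'
    have hm : Measurable (blockSum X s n H h q') :=
      measurable_blockSum hH fun i h1 h2 => hX n i (Finset.mem_Icc.2 (by lia))
    refine .of_bound (by fun_prop) ((q' * 1) ^ 2) (ae_of_all _ fun ω => ?_)
    rw [Real.norm_eq_abs, abs_pow]
    exact pow_le_pow_left₀ (abs_nonneg _) (abs_blockSum_le (K := 1)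
      (fun x => by rw [abs_of_nonneg (hH0 x)]; exact hH1 x) h q' ω) 2
  have hi : ∀ i ∈ Finset.range k, i * q + q + s n ≤ n + 1 := by
    intro i hi
    have : (i + 1) * q ≤ k * q := Nat.mul_le_mul_right _ (Finset.mem_range.1 hi)
    rw [Nat.succ_mul] at this
    lia
  calc (k : ℝ) * ∫ ω, blockSum X s n H 0 q ω ^ 2 ∂(μ n)
      = ∑ i ∈ Finset.range k, ∫ ω, blockSum X s n H (i * q) q ω ^ 2 ∂(μ n) := by
        rw [Finset.sum_congr rfl fun i h => ?_, Finset.sum_const, Finset.card_range, nsmul_eq_mul]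
        exact ((identDistrib_blockSum hX hst hH (h := i * q) (q := q) (s := s) (n := n)
          (hi i h)).comp (u := fun x => x ^ 2) (by fun_prop)).integral_eq
    _ = ∫ ω, ∑ i ∈ Finset.range k, blockSum X s n H (i * q) q ω ^ 2 ∂(μ n) :=
        (integral_finsetSum _ fun i h => hint _ _ (hi i h)).symm
    _ ≤ ∫ ω, blockSum X s n H 0 R ω ^ 2 ∂(μ n) := by
        refine integral_mono (integrable_finsetSum _ fun i h => hint _ _ (hi i h))
          (hint 0 R (by lia)) fun ω => ?_
        dsimp only
        have e : blockSum X s n H 0 R ω = blockSum X s n H 0 (k * q) ω +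
            blockSum X s n H (0 + k * q) (R - k * q) ω := by
          rw [← blockSum_add, Nat.add_sub_cancel' hk]
        calc ∑ i ∈ Finset.range k, blockSum X s n H (i * q) q ω ^ 2
            ≤ (∑ i ∈ Finset.range k, blockSum X s n H (i * q) q ω) ^ 2 :=
              Finset.sum_sq_le_sq_sum_of_nonneg fun i _ => hnn _ _ _
          _ = blockSum X s n H 0 (k * q) ω ^ 2 := by rw [blockSum_mul]
          _ ≤ blockSum X s n H 0 R ω ^ 2 := by
              refine pow_le_pow_left₀ (hnn _ _ _) ?_ 2
              rw [e]
              exact le_add_of_nonneg_right (hnn _ _ _)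

end

/-! ### The normalized and centered functions -/

noncomputable section

section

variable {E : Type*} {Ω : ℕ → Type*} {X : ∀ n, ℕ → Ω n → E} {s l r : ℕ → ℕ+}
  {𝒢 : Set (Vectors E → ℝ)} {b : ℕ → 𝒢 → ℝ} {M : ℝ} {n : ℕ}

lemma abs_le_of_envelope_le {M : ℝ≥0} (hM : ∀ x, envelope 𝒢 x ≤ M) (g : 𝒢) (x : Vectors E) :
    |g.1 x| ≤ M := by
  have h := (le_iSup (fun g : 𝒢 => ‖g.1 x‖ₑ) g).trans (hM x)
  simpa [enorm_le_coe, ← NNReal.coe_le_coe] using h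

/-- The blocks process `V_n` in terms of `blockSum`. -/
lemma bigBlock_one_eq (g : 𝒢) (ω : Ω n) :
    bigBlock X s r b n 1 g ω = blockSum X s n g.1 0 (r n) ω / b n g := by
  simp [bigBlock, blockSum_eq_sum_Icc]

lemma blockSum_sum_mul {ι : Type*} (I : Finset ι) (u : ι → ℝ) (G : ι → Vectors E → ℝ)
    (h q : ℕ) (ω : Ω n) :
    blockSum X s n (fun x => ∑ t ∈ I, u t * G t x) h q ω =
      ∑ t ∈ I, u t * blockSum X s n (G t) h q ω := by
  simp only [blockSum, Finset.mul_sum]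
  exact Finset.sum_comm

variable [∀ n, MeasurableSpace (Ω n)]

/-- The function `(√p_n b_n(g))⁻¹ (g - E g(Y_{n,1}))`. -/
def normalized (μ : ∀ n, Measure (Ω n)) (X : ∀ n, ℕ → Ω n → E) (s r : ℕ → ℕ+)
    {𝒢 : Set (Vectors E → ℝ)} (b : ℕ → 𝒢 → ℝ) (n : ℕ) (g : 𝒢) (x : Vectors E) : ℝ :=
  (g.1 x - ∫ ω, g.1 (block X s n 1 ω) ∂(μ n)) / (√(hitProb μ X s r b n) * b n g)

variable {μ : ∀ n, Measure (Ω n)}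

lemma blockSum_normalized (g : 𝒢) (q : ℕ) (ω : Ω n) :
    blockSum X s n (normalized μ X s r b n g) 0 q ω =
      (blockSum X s n g.1 0 q ω - q * ∫ ω, g.1 (block X s n 1 ω) ∂(μ n)) /
        (√(hitProb μ X s r b n) * b n g) := by
  simp only [blockSum, normalized]
  rw [← Finset.sum_div, Finset.sum_sub_distrib]
  simp

lemma abs_normalized_le [∀ n, IsProbabilityMeasure (μ n)] (hM : ∀ (g : 𝒢) x, |g.1 x| ≤ M)
    (hb : ∀ g, 0 < b n g)
    (hpos : 0 < √(hitProb μ X s r b n) * ⨅ g, b n g) (g : 𝒢) (x : Vectors E) :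
    |normalized μ X s r b n g x| ≤ 2 * M / (√(hitProb μ X s r b n) * ⨅ g, b n g) := by
  have hle : √(hitProb μ X s r b n) * ⨅ g, b n g ≤ √(hitProb μ X s r b n) * b n g :=
    mul_le_mul_of_nonneg_left (ciInf_le ⟨0, by rintro _ ⟨g, rfl⟩; exact (hb g).le⟩ g)
      (Real.sqrt_nonneg _)
  have hI : |∫ ω, g.1 (block X s n 1 ω) ∂(μ n)| ≤ M := by
    simpa using norm_integral_le_of_norm_le_const (μ := μ n) (C := M)
      (f := fun ω => g.1 (block X s n 1 ω)) (ae_of_all _ fun ω => hM g _)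
  have hM0 : 0 ≤ M := (abs_nonneg _).trans (hM g x)
  rw [normalized, abs_div, abs_of_pos (hpos.trans_le hle)]
  refine div_le_div₀ (by positivity) ?_ hpos hle
  calc _ ≤ |g.1 x| + |∫ ω, g.1 (block X s n 1 ω) ∂(μ n)| := abs_sub _ _
    _ ≤ 2 * M := by linarith [hM g x]

variable [MeasurableSpace E]

lemma measurable_normalized (h𝒢 : ∀ g ∈ 𝒢, Measurable g) (g : 𝒢) :
    Measurable (normalized μ X s r b n g) :=
  ((h𝒢 g g.2).sub_const _).div_const _

lemma integral_block_eq (hX : ∀ n, ∀ i ∈ Finset.Icc 1 n, Measurable (X n i))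
    (hst : ∀ n, IsStationaryRow (μ n) n (X n)) {G : Vectors E → ℝ} (hG : Measurable G) {j : ℕ}
    (hj : 1 ≤ j) (hjn : j + s n ≤ n + 1) :
    ∫ ω, G (block X s n j ω) ∂(μ n) = ∫ ω, G (block X s n 1 ω) ∂(μ n) := by
  have h := (identDistrib_blockSum hX hst hG (h := j - 1) (q := 1) (s := s) (n := n)
    (by lia)).integral_eq
  simpa [blockSum, Nat.sub_add_cancel hj] using h

lemma centeredSum_eq_blockSum (hX : ∀ n, ∀ i ∈ Finset.Icc 1 n, Measurable (X n i))
    (hst : ∀ n, IsStationaryRow (μ n) n (X n)) (h𝒢 : ∀ g ∈ 𝒢, Measurable g) {N : ℕ}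
    (hN : N ≤ n + 1 - s n) (g : 𝒢) (ω : Ω n) :
    centeredSum μ X s r b N n g ω = blockSum X s n (normalized μ X s r b n g) 0 N ω := by
  rw [blockSum_eq_sum_Icc, centeredSum, Finset.sum_div]
  refine Finset.sum_congr rfl fun j hj => ?_
  have hj' := Finset.mem_Icc.1 hj
  rw [integral_block_eq hX hst (h𝒢 g g.2) hj'.1 (by lia), normalized]

variable [∀ n, IsProbabilityMeasure (μ n)]

lemma integrable_comp_block (hX : ∀ n, ∀ i ∈ Finset.Icc 1 n, Measurable (X n i))
    {G : Vectors E → ℝ} (hG : Measurable G) (hM : ∀ x, |G x| ≤ M) {j : ℕ} (hj : 1 ≤ j)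
    (hjn : j + s n ≤ n + 1) : Integrable (fun ω => G (block X s n j ω)) (μ n) :=
  .of_bound (measurable_comp_block hG fun i h1 h2 =>
    hX n i (Finset.mem_Icc.2 (by lia))).aestronglyMeasurable M (ae_of_all _ fun _ => hM _)

lemma integral_normalized (hX : ∀ n, ∀ i ∈ Finset.Icc 1 n, Measurable (X n i))
    (h𝒢 : ∀ g ∈ 𝒢, Measurable g) (hM : ∀ (g : 𝒢) x, |g.1 x| ≤ M) (hs : (s n : ℕ) ≤ n) (g : 𝒢) :
    ∫ ω, normalized μ X s r b n g (block X s n 1 ω) ∂(μ n) = 0 := by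
  simp only [normalized]
  rw [integral_div, integral_sub (integrable_comp_block hX (h𝒢 g g.2) (hM g) le_rfl (by lia))
    (integrable_const _)]
  simp

lemma integral_mul_blockSum_normalized (hX : ∀ n, ∀ i ∈ Finset.Icc 1 n, Measurable (X n i))
    (hst : ∀ n, IsStationaryRow (μ n) n (X n)) (h𝒢 : ∀ g ∈ 𝒢, Measurable g)
    (hM : ∀ (g : 𝒢) x, |g.1 x| ≤ M) (hr : (r n + s n : ℕ) ≤ n + 1) (g h : 𝒢) :
    ∫ ω, blockSum X s n (normalized μ X s r b n g) 0 (r n) ω *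
        blockSum X s n (normalized μ X s r b n h) 0 (r n) ω ∂(μ n) =
      cov[bigBlock X s r b n 1 g, bigBlock X s r b n 1 h; μ n] / hitProb μ X s r b n := by
  have hE : ∀ g : 𝒢, ∫ ω, bigBlock X s r b n 1 g ω ∂(μ n) =
      (r n : ℕ) * (∫ ω, g.1 (block X s n 1 ω) ∂(μ n)) / b n g := fun g => by
    simp_rw [bigBlock_one_eq]
    rw [integral_div, integral_blockSum_eq hX hst (h𝒢 g g.2) (hM g) hr]
  rw [covariance, ← integral_div, hE, hE]
  refine integral_congr_ae (ae_of_all _ fun ω => ?_)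
  have hp : 0 ≤ hitProb μ X s r b n := measureReal_nonneg
  dsimp only
  rw [blockSum_normalized, blockSum_normalized, bigBlock_one_eq, bigBlock_one_eq, ← sub_div,
    ← sub_div, div_mul_div_comm, div_mul_div_comm, div_div]
  congr 1
  nth_rewrite 3 [← Real.mul_self_sqrt hp]
  ring

/-- The contribution of the stretches of length `l_n` that separate the big blocks vanishes. -/
lemma tendsto_mul_integral_blockSum_normalized_sq
    (hX : ∀ n, ∀ i ∈ Finset.Icc 1 n, Measurable (X n i))
    (hst : ∀ n, IsStationaryRow (μ n) n (X n)) (h𝒢 : ∀ g ∈ 𝒢, Measurable g)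
    (hM : ∀ (g : 𝒢) x, |g.1 x| ≤ M) (hsl : ∀ n, s n ≤ l n)
    (hlr : (fun n => (l n : ℝ)) =o[atTop] (fun n => (r n : ℝ)))
    (hrn : (fun n => (r n : ℝ)) =o[atTop] (fun n : ℕ => (n : ℝ)))
    (hb : ∀ n g, 0 < b n g) (hp : ∀ᶠ n in atTop, 0 < hitProb μ X s r b n) (g : 𝒢)
    (hcount : (fun n => ∫ ω, (∑ j ∈ Finset.Icc 1 (r n : ℕ),
          Set.indicator {ω' | g.1 (block X s n j ω') ≠ 0} (fun _ => (1 : ℝ)) ω) ^ 2 ∂(μ n))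
        =O[atTop] (fun n => hitProb μ X s r b n * b n g ^ 2 / (numBlocks s r n : ℝ))) :
    Tendsto (fun n => numBlocks s r n *
      ∫ ω, blockSum X s n (normalized μ X s r b n g) 0 (l n) ω ^ 2 ∂(μ n)) atTop (𝓝 0) := by
  let H : Vectors E → ℝ := Set.indicator {x | g.1 x ≠ 0} fun _ => 1
  have hH : Measurable H :=
    measurable_const.indicator ((h𝒢 g g.2) (measurableSet_singleton (0 : ℝ)).compl)
  have hH0 : ∀ x, 0 ≤ H x := Set.indicator_nonneg fun _ _ => zero_le_one
  have hH1 : ∀ x, H x ≤ 1 := Set.indicator_le_self' (fun _ _ => zero_le_one)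
  have hgH : ∀ x, |g.1 x| ≤ M * H x := by
    intro x
    by_cases hx : g.1 x = 0
    · simp [H, hx]
    · simpa [H, hx] using hM g x
  have hcnt : ∀ n, ∫ ω, (∑ j ∈ Finset.Icc 1 (r n : ℕ),
      Set.indicator {ω' | g.1 (block X s n j ω') ≠ 0} (fun _ => (1 : ℝ)) ω) ^ 2 ∂(μ n) =
      ∫ ω, blockSum X s n H 0 (r n) ω ^ 2 ∂(μ n) := by
    intro n
    simp only [blockSum_eq_sum_Icc]
    rfl
  simp_rw [hcnt] at hcount
  obtain ⟨C, hC⟩ := hcount.bound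
  have hdiv : Tendsto (fun n => (((r n : ℕ) / (l n : ℕ) : ℕ) : ℝ)) atTop atTop := by
    refine tendsto_natCast_atTop_atTop.comp (tendsto_atTop.2 fun k => ?_)
    filter_upwards [eventually_mul_le_of_isLittleO (f := fun n => r n) hlr k] with n hn
    exact (Nat.le_div_iff_mul_le (l n).pos).2 hn
  have hlim : Tendsto (fun n => M ^ 2 * C / (((r n : ℕ) / (l n : ℕ) : ℕ) : ℝ)) atTop (𝓝 0) :=
    tendsto_const_nhds.div_atTop hdiv
  refine squeeze_zero' (Eventually.of_forall fun n => mul_nonneg (Nat.cast_nonneg _)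
    (integral_nonneg fun ω => sq_nonneg _)) ?_ hlim
  filter_upwards [hC, hp, (tendsto_numBlocks hsl hlr hrn).eventually_ge_atTop 1,
    eventually_mul_le_of_isLittleO (f := fun n => r n) hlr 2, hdiv.eventually_gt_atTop 0,
    eventually_mul_le_of_isLittleO (f := fun n => n) hrn 2] with n h1 h2 h3 h4 h5 h6
  have hsl' : (s n : ℕ) ≤ l n := hsl n
  have hbn := hb n g
  set p := hitProb μ X s r b n
  set k := (r n : ℕ) / (l n : ℕ)
  have hm : (0 : ℝ) < numBlocks s r n := by exact_mod_cast h3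
  have hshort := mul_integral_blockSum_sq_le (μ := μ) (q := l n) hX hst hH hH0 hH1 (k := k)
    (Nat.div_mul_le_self _ _) (R := r n) (s := s) (n := n) (by lia)
  rw [Real.norm_of_nonneg (integral_nonneg fun ω => sq_nonneg _),
    Real.norm_of_nonneg (by positivity)] at h1
  have hmeas : ∀ {G : Vectors E → ℝ}, Measurable G → Measurable (blockSum X s n G 0 (l n)) :=
    fun hG => measurable_blockSum hG fun i h1 h2 => hX n i (Finset.mem_Icc.2 (by lia))
  have hvar : ∫ ω, blockSum X s n (normalized μ X s r b n g) 0 (l n) ω ^ 2 ∂(μ n) ≤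
      (∫ ω, blockSum X s n g.1 0 (l n) ω ^ 2 ∂(μ n)) / (p * b n g ^ 2) := by
    have hv := variance_le_expectation_sq (μ := μ n)
      (hmeas (h𝒢 g g.2)).aestronglyMeasurable
    rw [variance_eq_integral (hmeas (h𝒢 g g.2)).aemeasurable,
      integral_blockSum_eq hX hst (h𝒢 g g.2) (hM g) (by lia)] at hv
    have e : ∀ ω, blockSum X s n (normalized μ X s r b n g) 0 (l n) ω ^ 2 =
        (blockSum X s n g.1 0 (l n) ω -
          (l n : ℕ) * ∫ ω, g.1 (block X s n 1 ω) ∂(μ n)) ^ 2 / (p * b n g ^ 2) := fun ω => by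
      rw [blockSum_normalized, div_pow, mul_pow, Real.sq_sqrt h2.le]
    simp_rw [e]
    rw [integral_div]
    exact div_le_div_of_nonneg_right hv (by positivity)
  have hHle : ∫ ω, blockSum X s n g.1 0 (l n) ω ^ 2 ∂(μ n) ≤
      M ^ 2 * ∫ ω, blockSum X s n H 0 (l n) ω ^ 2 ∂(μ n) := by
    rw [← integral_const_mul]
    refine integral_mono_of_nonneg (ae_of_all _ fun ω => sq_nonneg _) ?_ (ae_of_all _ fun ω => ?_)
    · refine Integrable.const_mul (.of_bound ((hmeas hH).pow_const 2).aestronglyMeasurable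
        (((l n : ℕ) * 1) ^ 2) (ae_of_all _ fun ω => ?_)) _
      rw [Real.norm_eq_abs, abs_pow]
      exact pow_le_pow_left₀ (abs_nonneg _) (abs_blockSum_le (K := 1)
        (fun x => by rw [abs_of_nonneg (hH0 x)]; exact hH1 x) _ _ ω) 2
    · dsimp only
      rw [← mul_pow, ← sq_abs]
      refine pow_le_pow_left₀ (abs_nonneg _) ?_ 2
      simp only [blockSum, Finset.mul_sum]
      exact (Finset.abs_sum_le_sum_abs _ _).trans (Finset.sum_le_sum fun j _ => hgH _)
  set S := ∫ ω, blockSum X s n H 0 (l n) ω ^ 2 ∂(μ n)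
  have hS : S ≤ C * (p * b n g ^ 2 / numBlocks s r n) / k := by
    rw [le_div_iff₀ h5, mul_comm]
    exact hshort.trans h1
  calc (numBlocks s r n : ℝ) *
        ∫ ω, blockSum X s n (normalized μ X s r b n g) 0 (l n) ω ^ 2 ∂(μ n)
      ≤ numBlocks s r n * (M ^ 2 * (C * (p * b n g ^ 2 / numBlocks s r n) / k) /
          (p * b n g ^ 2)) := by
        gcongr
        refine hvar.trans ?_
        gcongr
        exact hHle.trans (by gcongr)
    _ = M ^ 2 * C / k := by
        field_simp

end

end

/-! ### Uniform approximation and convergence of linear combinations -/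

section

variable {E : Type*} {Ω : ℕ → Type*} [∀ n, MeasurableSpace (Ω n)]
  {X : ∀ n, ℕ → Ω n → E} {s l r : ℕ → ℕ+} {𝒢 : Set (Vectors E → ℝ)} {b : ℕ → 𝒢 → ℝ} {M : ℝ}
  {μ : ∀ n, Measure (Ω n)}

lemma eventually_sqrt_hitProb_mul_iInf_pos (hb : ∀ n g, 0 < b n g)
    (hrb : (fun n => (r n : ℝ)) =o[atTop] (fun n => √(hitProb μ X s r b n) * ⨅ g : 𝒢, b n g)) :
    ∀ᶠ n in atTop, 0 < √(hitProb μ X s r b n) * ⨅ g : 𝒢, b n g := by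
  filter_upwards [hrb.bound one_pos] with n hn
  have h0 : 0 ≤ √(hitProb μ X s r b n) * ⨅ g : 𝒢, b n g :=
    mul_nonneg (Real.sqrt_nonneg _) (Real.iInf_nonneg fun g => (hb n g).le)
  rw [Real.norm_of_nonneg h0, Real.norm_of_nonneg (by positivity), one_mul] at hn
  exact lt_of_lt_of_le (by exact_mod_cast (r n).pos) hn

lemma tendsto_mul_div_of_isLittleO {a ρ : ℕ → ℝ} (h : a =o[atTop] ρ) (C : ℝ) :
    Tendsto (fun n => a n * (C / ρ n)) atTop (𝓝 0) := by
  have := h.tendsto_div_nhds_zero.const_mul C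
  rw [mul_zero] at this
  exact this.congr fun n => by ring

variable [MeasurableSpace E]

lemma measurable_centeredSum (hX : ∀ n, ∀ i ∈ Finset.Icc 1 n, Measurable (X n i))
    (hst : ∀ n, IsStationaryRow (μ n) n (X n)) (h𝒢 : ∀ g ∈ 𝒢, Measurable g) {n N : ℕ}
    (hN : N ≤ n + 1 - s n) (g : 𝒢) : Measurable (centeredSum μ X s r b N n g) := by
  have e : centeredSum μ X s r b N n g = blockSum X s n (normalized μ X s r b n g) 0 N :=
    funext fun ω => centeredSum_eq_blockSum hX hst h𝒢 hN g ω
  rw [e]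
  rcases Nat.eq_zero_or_pos N with rfl | hpos
  · have e0 : blockSum X s n (normalized μ X s r b n g) 0 0 = fun _ => 0 :=
      funext fun ω => by simp [blockSum]
    rw [e0]
    exact measurable_const
  · exact measurable_blockSum (measurable_normalized h𝒢 g) fun i h1 h2 =>
      hX n i (Finset.mem_Icc.2 (by lia))

variable [∀ n, IsProbabilityMeasure (μ n)]

/-- The blocks omitted from `Z_n` contribute at most `2 M r_n / (√p_n inf b_n)`. -/
lemma abs_empBigBlock_sub_empSliding_le (hX : ∀ n, ∀ i ∈ Finset.Icc 1 n, Measurable (X n i))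
    (hst : ∀ n, IsStationaryRow (μ n) n (X n)) (h𝒢 : ∀ g ∈ 𝒢, Measurable g)
    (hM : ∀ (g : 𝒢) x, |g.1 x| ≤ M) {n : ℕ} (hb : ∀ g, 0 < b n g)
    (hpos : 0 < √(hitProb μ X s r b n) * ⨅ g, b n g) (g : 𝒢) (ω : Ω n) :
    |empBigBlock μ X s r b n g ω - empSliding μ X s r b n g ω| ≤
      r n * (2 * M / (√(hitProb μ X s r b n) * ⨅ g, b n g)) := by
  have hle := numBlocks_mul_le s r n
  rw [empBigBlock, empSliding, centeredSum_eq_blockSum hX hst h𝒢 hle,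
    centeredSum_eq_blockSum hX hst h𝒢 le_rfl]
  have e := blockSum_add (X := X) (s := s) (n := n) (G := normalized μ X s r b n g) 0
    (numBlocks s r n * r n) (n + 1 - s n - numBlocks s r n * r n) ω
  rw [Nat.add_sub_cancel' hle] at e
  have hK := abs_normalized_le (X := X) (s := s) (r := r) hM hb hpos g
  rw [e, sub_add_cancel_left, abs_neg]
  refine (abs_blockSum_le hK _ _ ω).trans ?_
  have hK0 := (abs_nonneg _).trans (hK ⟨1, fun _ => X n 0 ω⟩)
  gcongr
  exact (sub_numBlocks_mul_lt s r n).le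

/-- Limiting variance of the linear combinations. -/
lemma tendsto_mul_integral_blockSum_linear_sq
    (hX : ∀ n, ∀ i ∈ Finset.Icc 1 n, Measurable (X n i))
    (hst : ∀ n, IsStationaryRow (μ n) n (X n)) (h𝒢 : ∀ g ∈ 𝒢, Measurable g)
    (hM : ∀ (g : 𝒢) x, |g.1 x| ≤ M) (hb : ∀ n g, 0 < b n g)
    (hpos : ∀ᶠ n in atTop, 0 < √(hitProb μ X s r b n) * ⨅ g, b n g)
    (hrs : ∀ᶠ n in atTop, (r n + s n : ℕ) ≤ n + 1) {c : 𝒢 → 𝒢 → ℝ}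
    (hc : ∀ g h : 𝒢, Tendsto (fun n => (numBlocks s r n : ℝ) / hitProb μ X s r b n *
        cov[bigBlock X s r b n 1 g, bigBlock X s r b n 1 h; μ n]) atTop (𝓝 (c g h)))
    (I : Finset 𝒢) (u : I → ℝ) :
    Tendsto (fun n => numBlocks s r n * ∫ ω, blockSum X s n
      (fun x => ∑ t, u t * normalized μ X s r b n t x) 0 (r n) ω ^ 2 ∂(μ n)) atTop
      (𝓝 (∑ t, ∑ t', u t * u t' * c t t')) := by
  have hsum : Tendsto (fun n => ∑ t, ∑ t', u t * u t' * ((numBlocks s r n : ℝ) /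
      hitProb μ X s r b n * cov[bigBlock X s r b n 1 t, bigBlock X s r b n 1 t'; μ n])) atTop
      (𝓝 (∑ t, ∑ t', u t * u t' * c t t')) :=
    tendsto_finsetSum _ fun t _ => tendsto_finsetSum _ fun t' _ => (hc t t').const_mul _
  refine hsum.congr' ?_
  filter_upwards [hpos, hrs] with n h1 h2
  have hi : ∀ t t' : 𝒢, Integrable (fun ω => blockSum X s n (normalized μ X s r b n t) 0 (r n) ω *
      blockSum X s n (normalized μ X s r b n t') 0 (r n) ω) (μ n) := by
    have hmeas : ∀ t : 𝒢, Measurable (blockSum X s n (normalized μ X s r b n t) 0 (r n)) :=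
      fun t => measurable_blockSum (measurable_normalized h𝒢 t) fun i h1 h2 =>
        hX n i (Finset.mem_Icc.2 (by lia))
    have hbd := fun t => abs_blockSum_le (X := X) (s := s) (n := n)
      (abs_normalized_le (X := X) (s := s) (r := r) hM (hb n) h1 t) 0 (r n)
    exact fun t t' => (Integrable.of_bound (hmeas t').aestronglyMeasurable _
      (ae_of_all _ (hbd t'))).bdd_mul (hmeas t).aestronglyMeasurable (ae_of_all _ (hbd t))
  have e : ∀ ω, blockSum X s n (fun x => ∑ t, u t * normalized μ X s r b n t x) 0 (r n) ω ^ 2 =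
      ∑ t : I, ∑ t' : I, u t * u t' * (blockSum X s n (normalized μ X s r b n t) 0 (r n) ω *
        blockSum X s n (normalized μ X s r b n t') 0 (r n) ω) := by
    intro ω
    rw [blockSum_sum_mul, sq, Finset.sum_mul_sum]
    exact Finset.sum_congr rfl fun t _ => Finset.sum_congr rfl fun t' _ => by ring
  simp_rw [e]
  rw [integral_finsetSum _ fun (t : I) _ => integrable_finsetSum _ fun (t' : I) _ =>
    (hi t t').const_mul (u t * u t'), Finset.mul_sum]
  refine Finset.sum_congr rfl fun t _ => ?_
  rw [integral_finsetSum _ fun (t' : I) _ => (hi t t').const_mul (u t * u t'), Finset.mul_sum]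
  refine Finset.sum_congr rfl fun t' _ => ?_
  rw [integral_const_mul, integral_mul_blockSum_normalized hX hst h𝒢 hM h2]
  ring

lemma tendsto_mul_integral_blockSum_linear_sq_zero
    (hX : ∀ n, ∀ i ∈ Finset.Icc 1 n, Measurable (X n i)) (h𝒢 : ∀ g ∈ 𝒢, Measurable g)
    (hM : ∀ (g : 𝒢) x, |g.1 x| ≤ M) (hb : ∀ n g, 0 < b n g)
    (hpos : ∀ᶠ n in atTop, 0 < √(hitProb μ X s r b n) * ⨅ g, b n g)
    (hls : ∀ᶠ n in atTop, (l n + s n : ℕ) ≤ n + 1)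
    (h : ∀ g : 𝒢, Tendsto (fun n => numBlocks s r n *
      ∫ ω, blockSum X s n (normalized μ X s r b n g) 0 (l n) ω ^ 2 ∂(μ n)) atTop (𝓝 0))
    (I : Finset 𝒢) (u : I → ℝ) :
    Tendsto (fun n => numBlocks s r n * ∫ ω, blockSum X s n
      (fun x => ∑ t, u t * normalized μ X s r b n t x) 0 (l n) ω ^ 2 ∂(μ n)) atTop (𝓝 0) := by
  have hlim : Tendsto (fun n => (Finset.univ : Finset I).card * ∑ t, u t ^ 2 * (numBlocks s r n *
      ∫ ω, blockSum X s n (normalized μ X s r b n t) 0 (l n) ω ^ 2 ∂(μ n))) atTop (𝓝 0) := by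
    have := (tendsto_finsetSum (Finset.univ : Finset I) fun t _ =>
      (h t).const_mul (u t ^ 2)).const_mul ((Finset.univ : Finset I).card : ℝ)
    simpa using this
  refine squeeze_zero' (Eventually.of_forall fun n => mul_nonneg (Nat.cast_nonneg _)
    (integral_nonneg fun ω => sq_nonneg _)) ?_ hlim
  filter_upwards [hpos, hls] with n h1 h2
  have hi : ∀ t : 𝒢, Integrable
      (fun ω => blockSum X s n (normalized μ X s r b n t) 0 (l n) ω ^ 2) (μ n) := by
    intro t
    have hmeas : Measurable (blockSum X s n (normalized μ X s r b n t) 0 (l n)) :=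
      measurable_blockSum (measurable_normalized h𝒢 t) fun i h1 h2 =>
        hX n i (Finset.mem_Icc.2 (by lia))
    refine .of_bound (hmeas.pow_const 2).aestronglyMeasurable
      (((l n : ℕ) * (2 * M / (√(hitProb μ X s r b n) * ⨅ g, b n g))) ^ 2) (ae_of_all _ fun ω => ?_)
    rw [Real.norm_eq_abs, abs_pow]
    exact pow_le_pow_left₀ (abs_nonneg _)
      (abs_blockSum_le (abs_normalized_le hM (hb n) h1 t) _ _ ω) 2
  have hle : ∫ ω, blockSum X s n
      (fun x => ∑ t, u t * normalized μ X s r b n t x) 0 (l n) ω ^ 2 ∂(μ n) ≤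
      (Finset.univ : Finset I).card * ∑ t, u t ^ 2 *
        ∫ ω, blockSum X s n (normalized μ X s r b n t) 0 (l n) ω ^ 2 ∂(μ n) := by
    have e : ∀ t : I, u t ^ 2 * ∫ ω, blockSum X s n (normalized μ X s r b n t) 0 (l n) ω ^ 2
          ∂(μ n) =
        ∫ ω, u t ^ 2 * blockSum X s n (normalized μ X s r b n t) 0 (l n) ω ^ 2 ∂(μ n) :=
      fun t => (integral_const_mul _ _).symm
    simp_rw [e]
    rw [← integral_finsetSum _ fun (t : I) _ => (hi t).const_mul (u t ^ 2), ← integral_const_mul]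
    refine integral_mono_of_nonneg (ae_of_all _ fun ω => sq_nonneg _)
      ((integrable_finsetSum _ fun (t : I) _ => (hi t).const_mul (u t ^ 2)).const_mul _)
      (ae_of_all _ fun ω => ?_)
    dsimp only
    rw [blockSum_sum_mul]
    refine sq_sum_le_card_mul_sum_sq.trans (le_of_eq ?_)
    simp_rw [mul_pow]
  refine (mul_le_mul_of_nonneg_left hle (Nat.cast_nonneg _)).trans (le_of_eq ?_)
  rw [mul_left_comm, Finset.mul_sum]
  congr 1
  exact Finset.sum_congr rfl fun t _ => by ring

/-- Convergence of the characteristic functions of linear combinations of `Z_n`. -/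
lemma tendsto_integral_cexp_empBigBlock (hX : ∀ n, ∀ i ∈ Finset.Icc 1 n, Measurable (X n i))
    (hst : ∀ n, IsStationaryRow (μ n) n (X n)) (h𝒢 : ∀ g ∈ 𝒢, Measurable g)
    (hM : ∀ (g : 𝒢) x, |g.1 x| ≤ M) (hb : ∀ n g, 0 < b n g) (hsl : ∀ n, s n ≤ l n)
    (hlr : (fun n => (l n : ℝ)) =o[atTop] (fun n => (r n : ℝ)))
    (hrn : (fun n => (r n : ℝ)) =o[atTop] (fun n : ℕ => (n : ℝ)))
    (hrb : (fun n => (r n : ℝ)) =o[atTop] (fun n => √(hitProb μ X s r b n) * ⨅ g : 𝒢, b n g))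
    (hMX : Tendsto (fun n => (numBlocks s r n : ℝ≥0∞) *
      betaMixing (μ n) n (X n) (l n - s n : ℕ)) atTop (𝓝 0))
    (hcount : ∀ g : 𝒢, (fun n => ∫ ω, (∑ j ∈ Finset.Icc 1 (r n : ℕ),
          Set.indicator {ω' | g.1 (block X s n j ω') ≠ 0} (fun _ => (1 : ℝ)) ω) ^ 2 ∂(μ n))
        =O[atTop] (fun n => hitProb μ X s r b n * b n g ^ 2 / (numBlocks s r n : ℝ)))
    {c : 𝒢 → 𝒢 → ℝ}
    (hc : ∀ g h : 𝒢, Tendsto (fun n => (numBlocks s r n : ℝ) / hitProb μ X s r b n *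
        cov[bigBlock X s r b n 1 g, bigBlock X s r b n 1 h; μ n]) atTop (𝓝 (c g h)))
    (I : Finset 𝒢) (u : I → ℝ) :
    Tendsto (fun n => ∫ ω, Complex.exp (Complex.I *
      ((∑ t, u t * empBigBlock μ X s r b n t ω : ℝ) : ℂ)) ∂(μ n)) atTop
      (𝓝 (Complex.exp (-((∑ t, ∑ t', u t * u t' * c t t' : ℝ) : ℂ) / 2))) := by
  have hpos := eventually_sqrt_hitProb_mul_iInf_pos hb hrb
  have hp : ∀ᶠ n in atTop, 0 < hitProb μ X s r b n := hpos.mono fun n hn => by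
    by_contra h
    rw [Real.sqrt_eq_zero_of_nonpos (not_lt.1 h), zero_mul] at hn
    exact lt_irrefl _ hn
  have hn2 := eventually_mul_le_of_isLittleO (f := fun n => n) hrn 2
  have hr2 := eventually_mul_le_of_isLittleO (f := fun n => r n) hlr 2
  have hsl' : ∀ n, (s n : ℕ) ≤ l n := hsl
  have hrs : ∀ᶠ n in atTop, (r n + s n : ℕ) ≤ n + 1 := by
    filter_upwards [hn2, hr2] with n h1 h2
    have := hsl' n
    lia
  have hls : ∀ᶠ n in atTop, (l n + s n : ℕ) ≤ n + 1 := by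
    filter_upwards [hn2, hr2] with n h1 h2
    have := hsl' n
    lia
  have key := tendsto_integral_cexp_blockSum hX hst hsl hlr hrn hMX
    (G := fun n x => ∑ t : I, u t * normalized μ X s r b n t x)
    (K := fun n => 2 * ((∑ t, |u t|) * M) / (√(hitProb μ X s r b n) * ⨅ g, b n g))
    (fun n => Finset.measurable_fun_sum _ fun t _ => (measurable_normalized h𝒢 _).const_mul _)
    (hpos.mono fun n hn x => ?_) (tendsto_mul_div_of_isLittleO hrb _) ?_
    (tendsto_mul_integral_blockSum_linear_sq hX hst h𝒢 hM hb hpos hrs hc I u)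
    (tendsto_mul_integral_blockSum_linear_sq_zero hX h𝒢 hM hb hpos hls
      (fun g => tendsto_mul_integral_blockSum_normalized_sq hX hst h𝒢 hM hsl hlr hrn hb hp g
        (hcount g)) I u)
  · refine key.congr fun n => ?_
    have e : ∀ ω, blockSum X s n (fun x => ∑ t : I, u t * normalized μ X s r b n t x) 0
        (numBlocks s r n * r n) ω = ∑ t, u t * empBigBlock μ X s r b n t ω := fun ω => by
      rw [blockSum_sum_mul]
      refine Finset.sum_congr rfl fun t _ => ?_
      rw [empBigBlock, centeredSum_eq_blockSum hX hst h𝒢 (numBlocks_mul_le s r n)]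
    simp_rw [e]
  · calc |∑ t : I, u t * normalized μ X s r b n t x|
        ≤ ∑ t : I, |u t| * (2 * M / (√(hitProb μ X s r b n) * ⨅ g, b n g)) := by
          refine (Finset.abs_sum_le_sum_abs _ _).trans (Finset.sum_le_sum fun t _ => ?_)
          rw [abs_mul]
          exact mul_le_mul_of_nonneg_left (abs_normalized_le hM (hb n) hn t x) (abs_nonneg _)
      _ = 2 * ((∑ t, |u t|) * M) / (√(hitProb μ X s r b n) * ⨅ g, b n g) := by
          rw [← Finset.sum_mul]
          ring
  · filter_upwards [hrs, hpos] with n h1 h2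
    have hr1 := (r n).pos
    rw [integral_finsetSum]
    · refine Finset.sum_eq_zero fun t _ => ?_
      rw [integral_const_mul, integral_normalized hX h𝒢 hM (by lia), mul_zero]
    · exact fun t _ => (integrable_comp_block hX (measurable_normalized h𝒢 _)
        (abs_normalized_le hM (hb n) h2 t) le_rfl (by lia)).const_mul _

/-- Uniformly small perturbations do not change limits of characteristic functions. -/
lemma tendsto_integral_cexp_of_abs_sub_le {S S' : ∀ n, Ω n → ℝ} (hS : ∀ n, Measurable (S n))
    (hS' : ∀ n, Measurable (S' n)) {η : ℕ → ℝ} (hη : Tendsto η atTop (𝓝 0))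
    (h : ∀ᶠ n in atTop, ∀ ω, |S n ω - S' n ω| ≤ η n) {z : ℂ}
    (hz : Tendsto (fun n => ∫ ω, Complex.exp (Complex.I * (S n ω : ℂ)) ∂(μ n)) atTop (𝓝 z)) :
    Tendsto (fun n => ∫ ω, Complex.exp (Complex.I * (S' n ω : ℂ)) ∂(μ n)) atTop (𝓝 z) := by
  have hR : Tendsto (fun n => ∫ ω, Complex.exp (Complex.I * ((S' n ω - S n ω : ℝ) : ℂ)) ∂(μ n))
      atTop (𝓝 1) := by
    rw [tendsto_iff_norm_sub_tendsto_zero]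
    refine squeeze_zero' (Eventually.of_forall fun n => norm_nonneg _) ?_ hη
    filter_upwards [h] with n hn
    have hm : Measurable fun ω => S' n ω - S n ω := (hS' n).sub (hS n)
    have hi : Integrable (fun ω => Complex.exp (Complex.I * ((S' n ω - S n ω : ℝ) : ℂ))) (μ n) :=
      .of_bound (by fun_prop) 1 (ae_of_all _ fun ω => (Complex.norm_exp_I_mul_ofReal _).le)
    have e : ∫ ω, Complex.exp (Complex.I * ((S' n ω - S n ω : ℝ) : ℂ)) ∂(μ n) - 1 =
        ∫ ω, (Complex.exp (Complex.I * ((S' n ω - S n ω : ℝ) : ℂ)) - 1) ∂(μ n) := by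
      rw [integral_sub hi (integrable_const 1)]
      simp
    rw [e]
    have := norm_integral_le_of_norm_le_const (μ := μ n) (C := η n)
      (f := fun ω => Complex.exp (Complex.I * ((S' n ω - S n ω : ℝ) : ℂ)) - 1)
      (ae_of_all _ fun ω => Real.norm_exp_I_mul_ofReal_sub_one_le.trans
        (by rw [Real.norm_eq_abs, abs_sub_comm]; exact hn ω))
    simpa using this
  have := tendsto_integral_cexp_add
    (Eventually.of_forall fun n => ⟨hS n, (hS' n).sub (hS n)⟩) hz hR
  simpa using this

end

end SlidingBlocks

theorem theorem2p1
    {E : Type*} [NormedAddCommGroup E] [NormedSpace ℝ E] [CompleteSpace E]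
    [MeasurableSpace E] [BorelSpace E]
    -- the triangular array; row `n` is defined on the probability space `(Ω n, μ n)`
    {Ω : ℕ → Type*} [∀ n, MeasurableSpace (Ω n)]
    (μ : ∀ n, Measure (Ω n)) [∀ n, IsProbabilityMeasure (μ n)]
    (X : ∀ n, ℕ → Ω n → E) (hX : ∀ n, ∀ i ∈ Finset.Icc 1 n, Measurable (X n i))
    -- the function class, the lengths `s_n`, `l_n`, `r_n` and the normalization `b_n(g)`
    (𝒢 : Set (SlidingBlocks.Vectors E → ℝ)) (h𝒢 : ∀ g ∈ 𝒢, Measurable g)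
    (s l r : ℕ → ℕ+) (b : ℕ → 𝒢 → ℝ)
    -- `g_max` is bounded and measurable
    (hbdd : ∃ M : ℝ≥0, ∀ x, SlidingBlocks.envelope 𝒢 x ≤ M)
    (hmeas : Measurable (SlidingBlocks.envelope 𝒢))
    -- (A1)
    (hA1 : ∀ n, SlidingBlocks.IsStationaryRow (μ n) n (X n))
    -- (A2)
    (hb : ∀ n g, 0 < b n g)
    (hsl : ∀ n, s n ≤ l n)
    (hlr : (fun n => (l n : ℝ)) =o[atTop] (fun n => (r n : ℝ)))
    (hrn : (fun n => (r n : ℝ)) =o[atTop] (fun n : ℕ => (n : ℝ)))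
    (hp : Tendsto (SlidingBlocks.hitProb μ X s r b) atTop (𝓝 0))
    (hrb : (fun n => (r n : ℝ)) =o[atTop]
      (fun n => √(SlidingBlocks.hitProb μ X s r b n) * ⨅ g : 𝒢, b n g))
    -- (D0), for all `n` such that `V_n` only involves `X n 1, …, X n n`
    (hD0 : ∀ n, (r n + s n : ℕ) ≤ n + 1 →
      SlidingBlocks.IsSeparable (μ n) (SlidingBlocks.bigBlock X s r b n 1))
    -- (MX)
    (hMX : Tendsto (fun n => (SlidingBlocks.numBlocks s r n : ℝ≥0∞) *
      SlidingBlocks.betaMixing (μ n) n (X n) (l n - s n : ℕ)) atTop (𝓝 0))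
    -- the second moment bound
    (hcount : ∀ g : 𝒢,
      (fun n => ∫ ω, (∑ j ∈ Finset.Icc 1 (r n : ℕ),
          Set.indicator {ω' | g.1 (SlidingBlocks.block X s n j ω') ≠ 0} (fun _ => (1 : ℝ)) ω) ^ 2
          ∂(μ n)) =O[atTop]
        (fun n => SlidingBlocks.hitProb μ X s r b n * b n g ^ 2 /
          (SlidingBlocks.numBlocks s r n : ℝ))) :
    -- uniform approximation
    SlidingBlocks.TendstoZeroOuterProb μ (fun n ω => ⨆ g : 𝒢,
      ‖SlidingBlocks.empBigBlock μ X s r b n g ω -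
        SlidingBlocks.empSliding μ X s r b n g ω‖ₑ) ∧
    -- convergence of the fidis under (C)
    ∀ c : 𝒢 → 𝒢 → ℝ,
      (∀ g h : 𝒢, Tendsto (fun n =>
        (SlidingBlocks.numBlocks s r n : ℝ) / SlidingBlocks.hitProb μ X s r b n *
          cov[SlidingBlocks.bigBlock X s r b n 1 g, SlidingBlocks.bigBlock X s r b n 1 h; μ n])
        atTop (𝓝 (c g h))) →
      ∃ (Q : Measure (𝒢 → ℝ)) (_ : IsProbabilityMeasure Q),
        IsGaussianProcess (fun (g : 𝒢) (z : 𝒢 → ℝ) => z g) Q ∧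
        (∀ g : 𝒢, ∫ z, z g ∂Q = 0) ∧
        (∀ g h : 𝒢, cov[fun z : 𝒢 → ℝ => z g, fun z : 𝒢 → ℝ => z h; Q] = c g h) ∧
        SlidingBlocks.FidisTendsto μ (SlidingBlocks.empBigBlock μ X s r b) Q ∧
        SlidingBlocks.FidisTendsto μ (SlidingBlocks.empSliding μ X s r b) Q := by
  classical
  obtain ⟨M, hM'⟩ := hbdd
  have hM : ∀ (g : 𝒢) x, |g.1 x| ≤ M := SlidingBlocks.abs_le_of_envelope_le hM'
  have hpos := SlidingBlocks.eventually_sqrt_hitProb_mul_iInf_pos hb hrb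
  have hdiff : ∀ᶠ n in atTop, ∀ (g : 𝒢) ω,
      |SlidingBlocks.empBigBlock μ X s r b n g ω - SlidingBlocks.empSliding μ X s r b n g ω| ≤
      r n * (2 * M / (√(SlidingBlocks.hitProb μ X s r b n) * ⨅ g, b n g)) :=
    hpos.mono fun n hn => SlidingBlocks.abs_empBigBlock_sub_empSliding_le hX hA1 h𝒢 hM (hb n) hn
  have hη := SlidingBlocks.tendsto_mul_div_of_isLittleO hrb (2 * M)
  refine ⟨fun ε hε => ?_, fun c hc => ?_⟩
  · have hη' := (ENNReal.tendsto_ofReal hη).eventually (eventually_le_nhds (by simpa using hε))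
    refine tendsto_const_nhds.congr' ?_
    filter_upwards [hdiff, hη'] with n h1 h2
    symm
    convert measure_empty (μ := μ n)
    refine Set.eq_empty_of_forall_notMem fun ω hω => ?_
    refine absurd hω (not_lt.2 (iSup_le fun g => le_trans ?_ h2))
    rw [Real.enorm_eq_ofReal_abs]
    exact ENNReal.ofReal_le_ofReal (h1 g ω)
  · have hn2 := SlidingBlocks.eventually_mul_le_of_isLittleO (f := fun n => n) hrn 2
    have hr2 := SlidingBlocks.eventually_mul_le_of_isLittleO (f := fun n => r n) hlr 2
    have hrs : ∀ᶠ n in atTop, (r n + s n : ℕ) ≤ n + 1 := by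
      filter_upwards [hn2, hr2] with n h1 h2
      have : (s n : ℕ) ≤ l n := hsl n
      lia
    have hpsd : ∀ I : Finset 𝒢, (SlidingBlocks.kernelMatrix c I).PosSemidef := by
      refine fun I => .of_dotProduct_mulVec_nonneg ?_ fun x => ?_
      · ext g h
        refine tendsto_nhds_unique (hc h g) ((hc g h).congr fun n => ?_)
        rw [covariance_comm]
      · have := ge_of_tendsto' (SlidingBlocks.tendsto_mul_integral_blockSum_linear_sq hX hA1 h𝒢 hM
          hb hpos hrs hc I x) fun n => mul_nonneg (Nat.cast_nonneg _)
          (integral_nonneg fun ω => sq_nonneg _)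
        refine this.trans (le_of_eq ?_)
        simp only [dotProduct, Matrix.mulVec, Finset.mul_sum, Matrix.of_apply, star_trivial]
        exact Finset.sum_congr rfl fun i _ => Finset.sum_congr rfl fun j _ => by ring
    obtain ⟨Q, hQ, hQc⟩ := SlidingBlocks.exists_hasGaussianMarginals hpsd
    have hbig : ∀ n (g : 𝒢), Measurable (SlidingBlocks.empBigBlock μ X s r b n g) := fun n g =>
      SlidingBlocks.measurable_centeredSum hX hA1 h𝒢 (SlidingBlocks.numBlocks_mul_le s r n) g
    have hslid : ∀ n (g : 𝒢), Measurable (SlidingBlocks.empSliding μ X s r b n g) := fun n g =>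
      SlidingBlocks.measurable_centeredSum hX hA1 h𝒢 le_rfl g
    have hZ := SlidingBlocks.tendsto_integral_cexp_empBigBlock hX hA1 h𝒢 hM hb hsl hlr hrn hrb hMX
      hcount hc
    suffices hslidZ : ∀ (I : Finset 𝒢) (u : I → ℝ), Tendsto (fun n => ∫ ω, Complex.exp (Complex.I *
        ((∑ t, u t * SlidingBlocks.empSliding μ X s r b n t ω : ℝ) : ℂ)) ∂(μ n)) atTop
        (𝓝 (Complex.exp (-((∑ t, ∑ t', u t * u t' * c t t' : ℝ) : ℂ) / 2))) from
      ⟨Q, hQ, hQc.isGaussianProcess, hQc.integral_eval, hQc.covariance_eval hpsd,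
        SlidingBlocks.fidisTendsto_of_tendsto_cexp hbig hpsd hQc hZ,
        SlidingBlocks.fidisTendsto_of_tendsto_cexp hslid hpsd hQc hslidZ⟩
    intro I u
    have hη2 := hη.const_mul (∑ t, |u t|)
    rw [mul_zero] at hη2
    have hmb : ∀ n, Measurable fun ω => ∑ t, u t * SlidingBlocks.empBigBlock μ X s r b n t ω :=
      fun n => Finset.measurable_fun_sum _ fun t _ => (hbig n t).const_mul (u t)
    have hms : ∀ n, Measurable fun ω => ∑ t, u t * SlidingBlocks.empSliding μ X s r b n t ω :=
      fun n => Finset.measurable_fun_sum _ fun t _ => (hslid n t).const_mul (u t)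
    refine SlidingBlocks.tendsto_integral_cexp_of_abs_sub_le hmb hms hη2 ?_ (hZ I u)
    filter_upwards [hdiff] with n hn ω
    rw [← Finset.sum_sub_distrib, Finset.sum_mul]
    refine (Finset.abs_sum_le_sum_abs _ _).trans (Finset.sum_le_sum fun t _ => ?_)
    rw [← mul_sub, abs_mul]
    exact mul_le_mul_of_nonneg_left (hn t ω) (abs_nonneg _)
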